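/- Let $\mathcal P$ be a set of probability measures on a measurable space $(\Omega,\mathcal A)$ and $P\in\mathcal P$. For $g\in L_2(P)$, a path with tangent $g$ in $\mathcal P$ is a family $P_{g,s}$, $s>0$, of probability measures on $(\Omega,\mathcal A)$ with $P_{g,s}\in\mathcal P$ for all small $s>0$ and $$\sqrt{dP_{g,s}}=\bigl(1+\tfrac s2\,g\bigr)\sqrt{dP}+o(s)\qquad\text{as } s\downarrow0,$$ meaning that $\int\bigl(\sqrt{dP_{g,s}/d\mu_s}-(1+\tfrac s2 g)\sqrt{dP/d\mu_s}\bigr)^2d\mu_s=o(s^2)$ for dominating measures $\mu_s$. The tangent set $\mathcal G$ consists of all $g\in L_2(P)$ with $\int g\,dP=0$ for which such a path exists. Let $T:\mathcal P\to\mathbb R$ be differentiable at $P$: there is $\kappa\in L_2(P)$ such that $T(P_{g,s})=T(P)+s\langle\kappa|g\rangle+o(s)$ as $s\downarrow0$, for every $g\in\mathcal G$ and every path with tangent $g$ in $\mathcal P$. Assume that either (a) $\mathcal G$ is a closed convex cone with vertex at $0$, and $\tilde\kappa$ is the best approximation of $\kappa$ in $\mathcal G$; or (b) $\mathcal G$ is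 a closed linear space, and $\tilde\kappa$ is the orthogonal projection of $\kappa$ onto $\mathcal G$; and that $\tilde\kappa\neq0$. Let $\alpha\in(0,1)$, let $\Phi$ be the standard normal distribution function, let $u_\alpha$ be given by $\Phi(-u_\alpha)=\alpha$, and let $c\in(0,\infty)$. Consider the sequences $Q=(Q_n)$, $Q_n=P_{g,t/\sqrt n}$, for $t\in(0,\infty)$, $g\in\mathcal G$ and any path with tangent $g$ in $\mathcal P$. Let $H$ be the set of those $Q$ for which $\lim_n\sqrt n\,(T(Q_n)-T(P))\le0$, and $K$ the set of those for which $\lim_n\sqrt n\,(T(Q_n)-T(P))\ge c$. A test sequence is a sequence $\tau=(\tau_n)$ of measurable functions $\tau_n:\Omega^n\to[0,1]$; it has asymptotic level $\alpha$ at $P$ if $\limsup_n\int\tau_n\,dP^n\le\alpha$. Put $$\tilde\tau_n(x_1,\dots,x_n)=\mathbf 1\Bigl\{\tfrac1{\sqrt n}\sum_{i=1}^n\tilde\kappa(x_i)>\|\tilde\kappa\|\,u_\alpha\Bigr\},$$ where $\tilde\kappa(\cdot)$ is any measurable version of $\tilde\kappa$ and $\|\cdot\|$ is the norm of $L_2(P)$.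 Then $K\neq\emptyset$, and: 1. Every test sequence $\tau$ of asymptotic level $\alpha$ at $P$ satisfies $$\inf_{Q\in K}\limsup_{n\to\infty}\int\tau_n\,dQ_n^n\le\Phi\bigl(-u_\alpha+c/\|\tilde\kappa\|\bigr).$$ 2. The bound is achieved by $\tilde\tau=(\tilde\tau_n)$: this is a test sequence of asymptotic level $\alpha$ at $P$, and $$\inf_{Q\in K}\limsup_{n\to\infty}\int\tilde\tau_n\,dQ_n^n=\inf_{Q\in K}\liminf_{n\to\infty}\int\tilde\tau_n\,dQ_n^n=\Phi\bigl(-u_\alpha+c/\|\tilde\kappa\|\bigr).$$ 3. It is achieved uniquely up to $o_{P^n}(1)$: if a test sequence $\tau$ of asymptotic level $\alpha$ at $P$ satisfies $\inf_{Q\in K}\liminf_{n}\int\tau_n\,dQ_n^n\ge\Phi(-u_\alpha+c/\|\tilde\kappa\|)$, then $P^n(|\tau_n-\tilde\tau_n|\ge\varepsilon)\to0$ for every $\varepsilon>0$. 4. If $\mathcal G$ is a closed linear space, then moreover $\sup_{Q\in H}\limsup_{n\to\infty}\int\tilde\tau_n\,dQ_n^n\le\alpha$. -/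

import Mathlib

open MeasureTheory ProbabilityTheory Filter Asymptotics Topology

namespace OneSidedTesting

noncomputable section

/-- The squared norm of `√dQ - h √dP` in the Hilbert space of square roots of measures, i.e.
`∫ (√(dQ/dμ) - h √(dP/dμ))² dμ` for any dominating measure `μ`. It is written out along the Lebesgue
decomposition `dQ = (dQ/dP) dP + dQ^⊥` of `Q` with respect to `P`: on a `P`-null set that carries
`Q^⊥` the integrand is the density of `Q^⊥`, which contributes the mass of `Q^⊥`. -/
def sqrtDistSq {Ω : Type*} [MeasurableSpace Ω] (P Q : Measure Ω) (h : Ω → ℝ) : ℝ :=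
  ∫ x, (Real.sqrt (Q.rnDeriv P x).toReal - h x) ^ 2 ∂P + (Q.singularPart P).real Set.univ

/-- `γ` is a path `s ↦ P_{g,s}` at `P` inside the model `M` with tangent `g ∈ L₂(P)`:
`γ s ∈ M` for all small `s > 0`, and `√dP_{g,s} = (1 + (s/2) g) √dP + o(s)` as `s ↓ 0`. -/
def IsLocalPath {Ω : Type*} [MeasurableSpace Ω] (M : Set (ProbabilityMeasure Ω))
    (P : ProbabilityMeasure Ω) (g : Lp ℝ 2 (P : Measure Ω)) (γ : ℝ → ProbabilityMeasure Ω) : Prop :=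
  (∀ᶠ s in 𝓝[>] (0 : ℝ), γ s ∈ M) ∧
    (fun s : ℝ => sqrtDistSq (P : Measure Ω) (γ s : Measure Ω) (fun x => 1 + s / 2 * g x))
      =o[𝓝[>] (0 : ℝ)] (fun s : ℝ => s ^ 2)

/-- The tangent set `𝒢` of the model `M` at `P`: all `g ∈ L₂(P)` with `g ⊥ 1` that are the tangent
of some path inside `M`. -/
def tangentSet {Ω : Type*} [MeasurableSpace Ω] (M : Set (ProbabilityMeasure Ω))
    (P : ProbabilityMeasure Ω) : Set (Lp ℝ 2 (P : Measure Ω)) :=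
  {g | ∫ x, g x ∂(P : Measure Ω) = 0 ∧ ∃ γ : ℝ → ProbabilityMeasure Ω, IsLocalPath M P g γ}

/-- The functional `T` on `M` is differentiable at `P` with derivative `κ ∈ L₂(P)`:
`T(P_{g,s}) = T(P) + s ⟨κ|g⟩ + o(s)` as `s ↓ 0`, for every tangent `g`. Only values of `T` on `M`
matter. -/
def IsDifferentiableFunctional {Ω : Type*} [MeasurableSpace Ω] (M : Set (ProbabilityMeasure Ω))
    (P : ProbabilityMeasure Ω) (T : ProbabilityMeasure Ω → ℝ) (κ : Lp ℝ 2 (P : Measure Ω)) : Prop :=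
  ∀ g ∈ tangentSet M P, ∀ γ : ℝ → ProbabilityMeasure Ω, IsLocalPath M P g γ →
    (fun s : ℝ => T (γ s) - T P - s * inner ℝ κ g) =o[𝓝[>] (0 : ℝ)] (fun s : ℝ => s)

/-- `G` is a closed convex cone with vertex at `0`. -/
def IsClosedConvexCone {E : Type*} [NormedAddCommGroup E] [InnerProductSpace ℝ E]
    (G : Set E) : Prop :=
  G.Nonempty ∧ IsClosed G ∧
    ∀ g₁ ∈ G, ∀ g₂ ∈ G, ∀ a₁ a₂ : ℝ, 0 ≤ a₁ → 0 ≤ a₂ → a₁ • g₁ + a₂ • g₂ ∈ G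

/-- `G` is a closed linear space. -/
def IsClosedLinear {E : Type*} [NormedAddCommGroup E] [InnerProductSpace ℝ E]
    (G : Set E) : Prop :=
  IsClosed G ∧ ∃ V : Submodule ℝ E, (V : Set E) = G

/-- `κhat` is the (nonorthogonal) projection of `κ` onto the closure of `G`: the best approximation
of `κ` by elements of the closure. -/
def IsConeProjection {E : Type*} [NormedAddCommGroup E] [InnerProductSpace ℝ E]
    (G : Set E) (κ κhat : E) : Prop :=
  κhat ∈ closure G ∧ ∀ g ∈ closure G, ‖κ - κhat‖ ≤ ‖κ - g‖

/-- The orthogonal projection of `κ` onto the closed linear span of `G`. -/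
def linProjection {E : Type*} [NormedAddCommGroup E] [InnerProductSpace ℝ E] [CompleteSpace E]
    (G : Set E) (κ : E) : E :=
  (Submodule.span ℝ G).topologicalClosure.starProjection κ

/-- The local sequences `Q_n = P_{g, t/√n}` at `P` inside `M`, with `g` any tangent and
`t ∈ (0,∞)`. -/
def localSeqs {Ω : Type*} [MeasurableSpace Ω] (M : Set (ProbabilityMeasure Ω))
    (P : ProbabilityMeasure Ω) : Set (ℕ → ProbabilityMeasure Ω) :=
  {Q | ∃ g ∈ tangentSet M P, ∃ γ : ℝ → ProbabilityMeasure Ω, IsLocalPath M P g γ ∧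
    ∃ t : ℝ, 0 < t ∧ ∀ n : ℕ, Q n = γ (t / Real.sqrt n)}

/-- The hypothesis `H`: `lim √n (T(Q_n) - T(P)) ≤ 0`. -/
def hypH {Ω : Type*} [MeasurableSpace Ω] (M : Set (ProbabilityMeasure Ω))
    (P : ProbabilityMeasure Ω) (T : ProbabilityMeasure Ω → ℝ) :
    Set (ℕ → ProbabilityMeasure Ω) :=
  {Q | Q ∈ localSeqs M P ∧ ∃ l : ℝ, l ≤ 0 ∧
    Tendsto (fun n : ℕ => Real.sqrt n * (T (Q n) - T P)) atTop (𝓝 l)}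

/-- The alternative `K`: `lim √n (T(Q_n) - T(P)) ≥ c`. -/
def altK {Ω : Type*} [MeasurableSpace Ω] (M : Set (ProbabilityMeasure Ω))
    (P : ProbabilityMeasure Ω) (T : ProbabilityMeasure Ω → ℝ) (c : ℝ) :
    Set (ℕ → ProbabilityMeasure Ω) :=
  {Q | Q ∈ localSeqs M P ∧ ∃ l : ℝ, c ≤ l ∧
    Tendsto (fun n : ℕ => Real.sqrt n * (T (Q n) - T P)) atTop (𝓝 l)}

/-- `n`-fold product measure, the law of `n` i.i.d. observations from `Q`. -/
def iid {Ω : Type*} [MeasurableSpace Ω] (Q : ProbabilityMeasure Ω) (n : ℕ) :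
    Measure (Fin n → Ω) :=
  Measure.pi fun _ : Fin n => (Q : Measure Ω)

/-- `τ = (τ_n)` is a sequence of (possibly randomized) tests `τ_n : Ωⁿ → [0,1]`. -/
def IsTestSeq {Ω : Type*} [MeasurableSpace Ω] (τ : ∀ n : ℕ, (Fin n → Ω) → ℝ) : Prop :=
  ∀ n, Measurable (τ n) ∧ ∀ x, τ n x ∈ Set.Icc (0 : ℝ) 1

/-- `limsup ∫ τ_n dQ_nⁿ`. -/
def limsupPower {Ω : Type*} [MeasurableSpace Ω] (τ : ∀ n : ℕ, (Fin n → Ω) → ℝ)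
    (Q : ℕ → ProbabilityMeasure Ω) : ℝ :=
  limsup (fun n : ℕ => ∫ x, τ n x ∂(iid (Q n) n)) atTop

/-- `liminf ∫ τ_n dQ_nⁿ`. -/
def liminfPower {Ω : Type*} [MeasurableSpace Ω] (τ : ∀ n : ℕ, (Fin n → Ω) → ℝ)
    (Q : ℕ → ProbabilityMeasure Ω) : ℝ :=
  liminf (fun n : ℕ => ∫ x, τ n x ∂(iid (Q n) n)) atTop

/-- The standard normal distribution function. -/
def stdNormalCDF (x : ℝ) : ℝ := cdf (gaussianReal 0 1) x

open Classical in
/-- The tests `1{ n^{-1/2} ∑ k(x_i) > b }`. -/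
def sumTest {Ω : Type*} (k : Ω → ℝ) (b : ℝ) (n : ℕ) (x : Fin n → Ω) : ℝ :=
  if b < (Real.sqrt n)⁻¹ * ∑ i, k (x i) then 1 else 0

end

end OneSidedTesting

namespace OneSidedTesting

/-- The unnormalized density `exp (h / √n - a / n)`, cut off where `|h| > √n`. -/
noncomputable def truncTilt {Ω : Type*} (h : Ω → ℝ) (a : ℝ) (n : ℕ) (x : Ω) : ℝ :=
  if |h x| ≤ √n then Real.exp (h x / √n - a / n) else 0

section Expansion

theorem norm_cexp_sub_one_sub_self_le {z : ℂ} (hz : z.re ≤ 1) :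
    ‖Complex.exp z - 1 - z‖ ≤ 5 * ‖z‖ ^ 2 := by
  rcases le_total ‖z‖ 1 with h | h
  · have := Complex.norm_exp_sub_one_sub_id_le h
    nlinarith [sq_nonneg ‖z‖]
  · have h1 : ‖Complex.exp z‖ ≤ 3 := by
      rw [Complex.norm_exp]
      calc Real.exp z.re ≤ Real.exp 1 := Real.exp_le_exp.2 hz
        _ ≤ 3 := by linarith [Real.exp_one_lt_d9]
    have h2 : ‖Complex.exp z - 1 - z‖ ≤ ‖Complex.exp z‖ + 1 + ‖z‖ := by
      calc _ ≤ ‖Complex.exp z - 1‖ + ‖z‖ := norm_sub_le _ _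
        _ ≤ ‖Complex.exp z‖ + ‖(1 : ℂ)‖ + ‖z‖ := by gcongr; exact norm_sub_le _ _
        _ = _ := by simp
    nlinarith

theorem tendsto_mul_cexp_sub_one_sub (ζ a : ℂ) :
    Tendsto (fun n : ℕ => (n : ℂ) * (Complex.exp (ζ / (√n : ℝ) - a / n) - 1 - ζ / (√n : ℝ)))
      atTop (𝓝 (ζ ^ 2 / 2 - a)) := by
  set z : ℕ → ℂ := fun n => ζ / (√n : ℝ) - a / n with hz
  have hs : Tendsto (fun n : ℕ => (√n : ℝ)) atTop atTop :=
    Real.tendsto_sqrt_atTop.comp tendsto_natCast_atTop_atTop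
  have hsi : Tendsto (fun n : ℕ => (((√n : ℝ) : ℂ))⁻¹) atTop (𝓝 0) := by
    have := (Complex.continuous_ofReal.tendsto 0).comp (tendsto_inv_atTop_zero.comp hs)
    simpa [Function.comp_def] using this
  have hsq : ∀ n : ℕ, ((√n : ℝ) : ℂ) * ((√n : ℝ) : ℂ) = n := fun n => by
    rw [← Complex.ofReal_mul, Real.mul_self_sqrt (Nat.cast_nonneg n)]; simp
  have hsz : Tendsto (fun n : ℕ => ((√n : ℝ) : ℂ) * z n) atTop (𝓝 ζ) := by
    have h1 : Tendsto (fun n : ℕ => ζ - a * (((√n : ℝ) : ℂ))⁻¹) atTop (𝓝 (ζ - a * 0)) :=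
      tendsto_const_nhds.sub (hsi.const_mul a)
    rw [mul_zero, sub_zero] at h1
    refine h1.congr' ?_
    filter_upwards [eventually_gt_atTop 0] with n hn
    have h0 : ((√n : ℝ) : ℂ) ≠ 0 := by
      simpa using (Real.sqrt_pos.2 (Nat.cast_pos.2 hn)).ne'
    simp only [hz]
    rw [← hsq n]
    field_simp
  have hz0 : Tendsto z atTop (𝓝 0) := by
    have := hsi.mul hsz
    rw [zero_mul] at this
    refine this.congr' ?_
    filter_upwards [eventually_gt_atTop 0] with n hn
    have h0 : ((√n : ℝ) : ℂ) ≠ 0 := by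
      simpa using (Real.sqrt_pos.2 (Nat.cast_pos.2 hn)).ne'
    field_simp
  have hrem : Tendsto (fun n : ℕ => (n : ℂ) * (Complex.exp (z n) - 1 - z n - z n ^ 2 / 2)) atTop
      (𝓝 0) := by
    have hb : Tendsto (fun n : ℕ => ‖((√n : ℝ) : ℂ) * z n‖ ^ 2 * ‖z n‖) atTop (𝓝 0) := by
      have := (hsz.norm.pow 2).mul hz0.norm
      simpa using this
    refine squeeze_zero_norm' ?_ hb
    have hz1 : ∀ᶠ n in atTop, ‖z n‖ ≤ 1 := by
      have := hz0.norm
      rw [norm_zero] at this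
      exact this.eventually_le_const one_pos
    filter_upwards [hz1] with n hn
    have := Complex.exp_bound hn (n := 3) (by norm_num)
    simp only [Finset.sum_range_succ, Finset.sum_range_zero] at this
    norm_num [Nat.factorial] at this
    have h2 : ‖Complex.exp (z n) - 1 - z n - z n ^ 2 / 2‖ ≤ ‖z n‖ ^ 3 := by
      have e : Complex.exp (z n) - 1 - z n - z n ^ 2 / 2 =
          Complex.exp (z n) - (1 + z n + z n ^ 2 / 2) := by ring
      rw [e]
      nlinarith [pow_nonneg (norm_nonneg (z n)) 3]
    rw [norm_mul, norm_mul, mul_pow, ← norm_pow, pow_two ((√n : ℝ) : ℂ), hsq]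
    calc _ ≤ ‖(n : ℂ)‖ * ‖z n‖ ^ 3 := by gcongr
      _ = _ := by ring
  have hmain : Tendsto (fun n : ℕ => (n : ℂ) * (Complex.exp (z n) - 1 - z n - z n ^ 2 / 2)
      + (((√n : ℝ) : ℂ) * z n) ^ 2 / 2 - a) atTop (𝓝 (0 + ζ ^ 2 / 2 - a)) :=
    (hrem.add ((hsz.pow 2).div_const 2)).sub_const a
  rw [zero_add] at hmain
  refine hmain.congr' ?_
  filter_upwards [eventually_gt_atTop 0] with n hn
  have h0 : (n : ℂ) ≠ 0 := by exact_mod_cast hn.ne'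
  rw [mul_pow, pow_two ((√n : ℝ) : ℂ), hsq]
  have : ζ / (√n : ℝ) = z n + a / n := by simp [hz]
  rw [this, show z n + a / n - a / n = z n by ring]
  field_simp
  ring

variable {Ω : Type*} {h k : Ω → ℝ} {a : ℝ}

theorem truncTilt_nonneg (n : ℕ) (x : Ω) : 0 ≤ truncTilt h a n x := by
  unfold truncTilt; split_ifs <;> positivity

theorem truncTilt_le (n : ℕ) (x : Ω) : truncTilt h a n x ≤ Real.exp (1 + |a|) := by
  unfold truncTilt
  split_ifs with hx
  · refine Real.exp_le_exp.2 ?_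
    have h1 : h x / √n ≤ 1 := div_le_one_of_le₀ ((le_abs_self _).trans hx) (Real.sqrt_nonneg _)
    have h2 : -(a / n) ≤ |a| := by
      rcases Nat.eq_zero_or_pos n with rfl | hn
      · simp
      have hn' : (1 : ℝ) ≤ n := by exact_mod_cast hn
      calc -(a / n) ≤ |a / n| := neg_le_abs _
        _ = |a| / n := by rw [abs_div, abs_of_nonneg (by positivity : (0:ℝ) ≤ n)]
        _ ≤ |a| := div_le_self (abs_nonneg _) hn'
    linarith
  · positivity

theorem eventually_abs_le_sqrt (y : ℝ) : ∀ᶠ n : ℕ in atTop, |y| ≤ √n :=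
  (Real.tendsto_sqrt_atTop.comp tendsto_natCast_atTop_atTop).eventually_ge_atTop |y|

theorem norm_mul_cexp_mul_truncTilt_sub_le (ha : 0 ≤ a) (u : ℝ) {n : ℕ} (hn : 0 < n)
    (x : Ω) : ‖(n : ℂ) * (Complex.exp (u * k x * Complex.I / (√n : ℝ)) * truncTilt h a n x - 1
        - (u * k x * Complex.I + h x) / (√n : ℝ))‖
      ≤ 15 * (u ^ 2 * k x ^ 2 + h x ^ 2 + a ^ 2) + a := by
  have hn1 : (1 : ℝ) ≤ n := by exact_mod_cast hn
  have hs : 0 < √(n : ℝ) := Real.sqrt_pos.2 (by linarith)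
  have hss : √(n : ℝ) * √n = n := Real.mul_self_sqrt (by linarith)
  set ζ : ℂ := u * k x * Complex.I + h x with hζ
  have hζn : ‖ζ‖ ≤ |u| * |k x| + |h x| := by
    calc _ ≤ ‖(u * k x * Complex.I : ℂ)‖ + ‖(h x : ℂ)‖ := norm_add_le _ _
      _ = _ := by simp
  unfold truncTilt
  split_ifs with hx
  · set z : ℂ := ζ / (√n : ℝ) - a / n with hz
    have e1 : Complex.exp (u * k x * Complex.I / (√n : ℝ)) *
        ((Real.exp (h x / √n - a / n) : ℝ) : ℂ) = Complex.exp z := by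
      rw [Complex.ofReal_exp, ← Complex.exp_add]
      congr 1
      simp only [hz, hζ]
      push_cast
      ring
    have hre : z.re ≤ 1 := by
      have : z = ((h x / √n - a / n : ℝ) : ℂ) + ((u * k x / √n : ℝ) : ℂ) * Complex.I := by
        simp only [hz, hζ]; push_cast; ring
      rw [this]
      simp only [Complex.add_re, Complex.ofReal_re, Complex.mul_re, Complex.I_re, mul_zero,
        Complex.ofReal_im, Complex.I_im, zero_mul, sub_zero, add_zero]
      have h1 : h x / √n ≤ 1 := div_le_one_of_le₀ ((le_abs_self _).trans hx) hs.le
      have h2 : 0 ≤ a / n := by positivity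
      linarith
    rw [e1]
    have e2 : (n : ℂ) * (Complex.exp z - 1 - ζ / (√n : ℝ)) = n * (Complex.exp z - 1 - z) - a := by
      have h0 : (n : ℂ) ≠ 0 := by exact_mod_cast hn.ne'
      simp only [hz]
      field_simp
      ring
    rw [e2]
    have hzn : √n * ‖z‖ ≤ |u| * |k x| + |h x| + a := by
      have : ‖z‖ ≤ ‖ζ‖ / √n + a / n := by
        calc _ ≤ ‖ζ / (√n : ℝ)‖ + ‖(a / n : ℂ)‖ := norm_sub_le _ _
          _ = _ := by simp [abs_of_nonneg ha, abs_of_pos hs]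
      calc √n * ‖z‖ ≤ √n * (‖ζ‖ / √n + a / n) := by gcongr
        _ = ‖ζ‖ + a * (√n / n) := by field_simp
        _ ≤ (|u| * |k x| + |h x|) + a * 1 := by
            gcongr
            refine div_le_one_of_le₀ ?_ (by positivity)
            have : 1 ≤ √(n : ℝ) := Real.one_le_sqrt.2 hn1
            nlinarith
        _ = _ := by ring
    have hzz : n * ‖z‖ ^ 2 ≤ 3 * (u ^ 2 * k x ^ 2 + h x ^ 2 + a ^ 2) := by
      have : (√n * ‖z‖) ^ 2 ≤ (|u| * |k x| + |h x| + a) ^ 2 := by gcongr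
      rw [mul_pow, Real.sq_sqrt (by linarith)] at this
      rw [← sq_abs u, ← sq_abs (k x), ← sq_abs (h x)]
      nlinarith [sq_nonneg (|u| * |k x| - |h x|), sq_nonneg (|u| * |k x| - a),
        sq_nonneg (|h x| - a)]
    calc _ ≤ ‖(n : ℂ) * (Complex.exp z - 1 - z)‖ + ‖(a : ℂ)‖ := norm_sub_le _ _
      _ = n * ‖Complex.exp z - 1 - z‖ + a := by simp [abs_of_nonneg ha]
      _ ≤ n * (5 * ‖z‖ ^ 2) + a := by gcongr; exact norm_cexp_sub_one_sub_self_le hre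
      _ ≤ _ := by linarith
  · push Not at hx
    have e1 : (n : ℂ) * (Complex.exp (u * k x * Complex.I / (√n : ℝ)) * ((0 : ℝ) : ℂ) - 1 -
        ζ / (√n : ℝ)) = -(n + (√n : ℝ) * ζ) := by
      have : (n : ℂ) = ((√n : ℝ) : ℂ) * ((√n : ℝ) : ℂ) := by rw [← Complex.ofReal_mul, hss]; simp
      have h0 : ((√n : ℝ) : ℂ) ≠ 0 := by simpa using hs.ne'
      rw [this]
      field_simp
      push_cast
      ring
    rw [e1, norm_neg]
    have h1 : ‖(n : ℂ) + (√n : ℝ) * ζ‖ ≤ n + √n * (|u| * |k x| + |h x|) := by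
      calc _ ≤ ‖(n : ℂ)‖ + ‖(√n : ℝ) * ζ‖ := norm_add_le _ _
        _ = n + √n * ‖ζ‖ := by simp [abs_of_pos hs]
        _ ≤ _ := by gcongr
    have h2 : √n * (|u| * |k x| + |h x|) ≤ |h x| * (|u| * |k x| + |h x|) := by gcongr
    have h3 : (n : ℝ) ≤ |h x| ^ 2 := by rw [← hss]; nlinarith
    rw [← sq_abs u, ← sq_abs (k x), ← sq_abs (h x)]
    nlinarith [sq_nonneg (|u| * |k x| - |h x|), sq_nonneg (|u| * |k x|), sq_nonneg a]

variable [MeasurableSpace Ω] {P : Measure Ω} [IsProbabilityMeasure P]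

theorem measurable_truncTilt (hh : Measurable h) (n : ℕ) : Measurable (truncTilt h a n) := by
  unfold truncTilt
  exact Measurable.ite (measurableSet_le (by fun_prop) measurable_const) (by fun_prop)
    measurable_const

theorem integrable_truncTilt (hh : Measurable h) (n : ℕ) : Integrable (truncTilt h a n) P := by
  refine Integrable.of_bound (measurable_truncTilt hh n).aestronglyMeasurable
    (Real.exp (1 + |a|)) (ae_of_all _ fun x => ?_)
  rw [Real.norm_of_nonneg (truncTilt_nonneg n x)]
  exact truncTilt_le n x

theorem tendsto_integral_cexp_mul_truncTilt (hh : Measurable h) (hk : Measurable k)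
    (hh2 : MemLp h 2 P) (hk2 : MemLp k 2 P) (hh0 : ∫ x, h x ∂P = 0) (hk0 : ∫ x, k x ∂P = 0)
    (ha : 0 ≤ a) (u : ℝ) :
    Tendsto (fun n : ℕ => (n : ℂ) *
        (∫ x, Complex.exp (u * k x * Complex.I / (√n : ℝ)) * truncTilt h a n x ∂P - 1)) atTop
      (𝓝 (∫ x, ((u * k x * Complex.I + h x) ^ 2 / 2 - a : ℂ) ∂P)) := by
  have hhi : Integrable (fun x => (h x : ℂ)) P := (hh2.integrable one_le_two).ofReal
  have hki : Integrable (fun x => (k x : ℂ)) P := (hk2.integrable one_le_two).ofReal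
  have hint : ∀ n : ℕ, Integrable
      (fun x => Complex.exp (u * k x * Complex.I / (√n : ℝ)) * truncTilt h a n x) P := by
    intro n
    refine Integrable.of_bound (C := Real.exp (1 + |a|)) ?_ (ae_of_all _ fun x => ?_)
    · have := measurable_truncTilt (a := a) hh n
      exact Measurable.aestronglyMeasurable (by fun_prop)
    · have e : (u * k x * Complex.I / (√n : ℝ) : ℂ) = ((u * k x / √n : ℝ) : ℂ) * Complex.I := by
        push_cast; ring
      rw [norm_mul, e, Complex.norm_exp_ofReal_mul_I, one_mul, Complex.norm_real,
        Real.norm_of_nonneg (truncTilt_nonneg n x)]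
      exact truncTilt_le n x
  have hlim : Tendsto (fun n : ℕ => ∫ x, (n : ℂ) *
      (Complex.exp (u * k x * Complex.I / (√n : ℝ)) * truncTilt h a n x - 1
        - (u * k x * Complex.I + h x) / (√n : ℝ)) ∂P) atTop
      (𝓝 (∫ x, ((u * k x * Complex.I + h x) ^ 2 / 2 - a : ℂ) ∂P)) := by
    refine tendsto_integral_filter_of_dominated_convergence
      (fun x => 15 * (u ^ 2 * k x ^ 2 + h x ^ 2 + a ^ 2) + a) ?_ ?_ ?_ ?_
    · refine Eventually.of_forall fun n => Measurable.aestronglyMeasurable ?_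
      have := measurable_truncTilt (a := a) hh n
      fun_prop
    · filter_upwards [eventually_gt_atTop 0] with n hn
      exact ae_of_all _ fun x => norm_mul_cexp_mul_truncTilt_sub_le ha u hn x
    · exact ((((hk2.integrable_sq.const_mul _).add hh2.integrable_sq).add
        (integrable_const _)).const_mul _).add (integrable_const _)
    · refine ae_of_all _ fun x => ?_
      refine (tendsto_mul_cexp_sub_one_sub (u * k x * Complex.I + h x) a).congr' ?_
      filter_upwards [eventually_abs_le_sqrt (h x)] with n hn
      rw [truncTilt, if_pos hn, Complex.ofReal_exp, ← Complex.exp_add]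
      congr 4
      push_cast
      ring
  refine hlim.congr fun n => ?_
  have hone : Integrable (fun _ : Ω => (1 : ℂ)) P := integrable_const _
  have hsub : Integrable (fun x =>
      Complex.exp (u * k x * Complex.I / (√n : ℝ)) * truncTilt h a n x - 1) P := (hint n).sub hone
  rw [integral_const_mul, integral_sub hsub, integral_sub (hint n) hone, integral_div,
    integral_add, integral_mul_const,
    integral_const_mul, integral_complex_ofReal, integral_complex_ofReal, hh0, hk0]
  · simp
  · exact (hki.const_mul _).mul_const _
  · exact hhi
  · exact (((hki.const_mul _).mul_const _).add hhi).div_const _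

theorem tendsto_integral_truncTilt (hh : Measurable h) (hh2 : MemLp h 2 P)
    (hh0 : ∫ x, h x ∂P = 0) (ha : a = (∫ x, h x ^ 2 ∂P) / 2) :
    Tendsto (fun n : ℕ => (n : ℝ) * (∫ x, truncTilt h a n x ∂P - 1)) atTop (𝓝 0) := by
  have ha0 : 0 ≤ a := by
    have : 0 ≤ ∫ x, h x ^ 2 ∂P := integral_nonneg fun x => sq_nonneg _
    linarith
  have := tendsto_integral_cexp_mul_truncTilt (k := h) hh hh hh2 hh2 hh0 hh0 ha0 0
  have e : (∫ x, ((((0 : ℝ) : ℂ) * h x * Complex.I + h x) ^ 2 / 2 - a : ℂ) ∂P) = ((0 : ℝ) : ℂ) := by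
    have : ∀ x, ((((0 : ℝ) : ℂ) * h x * Complex.I + h x) ^ 2 / 2 - a : ℂ)
        = ((h x ^ 2 / 2 - a : ℝ) : ℂ) := fun x => by push_cast; ring
    simp_rw [this]
    rw [integral_complex_ofReal, integral_sub (hh2.integrable_sq.div_const _) (integrable_const _),
      integral_div, ← ha]
    simp
  rw [e] at this
  have h2 := (Complex.continuous_re.tendsto _).comp this
  refine h2.congr fun n => ?_
  have : ∫ x, Complex.exp (((0 : ℝ) : ℂ) * h x * Complex.I / (√n : ℝ)) * truncTilt h a n x ∂P =
      ((∫ x, truncTilt h a n x ∂P : ℝ) : ℂ) := by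
    rw [← integral_complex_ofReal]; simp
  simp only [Function.comp]
  rw [this, ← Complex.ofReal_one, ← Complex.ofReal_sub, ← Complex.ofReal_natCast,
    ← Complex.ofReal_mul, Complex.ofReal_re]

theorem tendsto_integral_sqrt_truncTilt_sub_sq (hh : Measurable h) (hh2 : MemLp h 2 P)
    (ha : 0 ≤ a) :
    Tendsto (fun n : ℕ => (n : ℝ) * ∫ x, (√(truncTilt h a n x) - (1 + h x / (2 * √n))) ^ 2 ∂P)
      atTop (𝓝 0) := by
  have hs : Tendsto (fun n : ℕ => (√n : ℝ)) atTop atTop :=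
    Real.tendsto_sqrt_atTop.comp tendsto_natCast_atTop_atTop
  simp_rw [← integral_const_mul]
  rw [← integral_zero Ω ℝ (μ := P)]
  have key : ∀ n : ℕ, ∀ x, (n : ℝ) * (√(truncTilt h a n x) - (1 + h x / (2 * √n))) ^ 2 =
      (√n * (√(truncTilt h a n x) - 1 - (h x / 2) / √n)) ^ 2 := fun n x => by
    rw [mul_pow, Real.sq_sqrt (Nat.cast_nonneg n)]
    congr 2
    ring
  simp_rw [key]
  have hroot : ∀ {n : ℕ} {x}, |h x| ≤ √n →
      √(truncTilt h a n x) = Real.exp ((h x / 2) / √n - (a / 2) / n) := fun {n x} hx => by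
    rw [truncTilt, if_pos hx, ← Real.exp_half]
    congr 1; ring
  refine tendsto_integral_filter_of_dominated_convergence
    (fun x => (3 * |h x| + a) ^ 2) ?_ ?_ ?_ ?_
  · refine Eventually.of_forall fun n => Measurable.aestronglyMeasurable ?_
    have := measurable_truncTilt (a := a) hh n
    fun_prop
  · filter_upwards [eventually_gt_atTop 0, eventually_ge_atTop ⌈a⌉₊] with n hn hna
    refine ae_of_all _ fun x => ?_
    have hna' : a ≤ n := (Nat.le_ceil a).trans (by exact_mod_cast hna)
    have hn1 : (1 : ℝ) ≤ n := by exact_mod_cast hn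
    have hs0 : 0 < √(n : ℝ) := Real.sqrt_pos.2 (by linarith)
    have hss : √(n : ℝ) * √n = n := Real.mul_self_sqrt (by linarith)
    rw [Real.norm_of_nonneg (sq_nonneg _)]
    rw [← sq_abs]
    refine pow_le_pow_left₀ (abs_nonneg _) ?_ 2
    · have hsplit : √n * (√(truncTilt h a n x) - 1 - (h x / 2) / √n) =
          √n * (√(truncTilt h a n x) - 1) - h x / 2 := by field_simp
      rw [hsplit]
      have hmain : |√n * (√(truncTilt h a n x) - 1)| ≤ |h x| + |h x| + a := by
        rw [abs_mul, abs_of_pos hs0]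
        by_cases hx : |h x| ≤ √n
        · rw [hroot hx]
          set y := (h x / 2) / √n - (a / 2) / n
          have hy : √n * |y| ≤ |h x| / 2 + a / 2 := by
            have : |y| ≤ (|h x| / 2) / √n + (a / 2) / n := by
              refine (abs_sub _ _).trans ?_
              rw [abs_div, abs_div, abs_div, abs_div, abs_of_pos hs0, abs_of_nonneg ha,
                abs_of_pos (by linarith : (0:ℝ) < n), abs_two]
            calc √n * |y| ≤ √n * ((|h x| / 2) / √n + (a / 2) / n) := by gcongr
              _ = |h x| / 2 + a / 2 * (√n / n) := by field_simp
              _ ≤ |h x| / 2 + a / 2 * 1 := by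
                gcongr
                refine div_le_one_of_le₀ ?_ (by positivity)
                have : 1 ≤ √(n : ℝ) := Real.one_le_sqrt.2 hn1
                nlinarith
              _ = _ := by ring
          have hy1 : |y| ≤ 1 := by
            have h1 : |(h x / 2) / √n| ≤ 1 / 2 := by
              rw [abs_div, abs_div, abs_of_pos hs0, abs_two, div_le_iff₀ hs0]
              linarith
            have h2 : |(a / 2) / n| ≤ 1 / 2 := by
              rw [abs_of_nonneg (by positivity), div_le_iff₀ (by linarith)]
              linarith
            exact (abs_sub _ _).trans (by linarith)
          have := Real.abs_exp_sub_one_le hy1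
          calc √n * |Real.exp y - 1| ≤ √n * (2 * |y|) := by gcongr
            _ ≤ |h x| + a := by linarith
            _ ≤ _ := by linarith [abs_nonneg (h x)]
        · have : truncTilt h a n x = 0 := by rw [truncTilt, if_neg hx]
          rw [this]
          push Not at hx
          simp only [Real.sqrt_zero, zero_sub, abs_neg, abs_one, mul_one]
          linarith [abs_nonneg (h x)]
      have h3 : |h x / 2| ≤ |h x| := by
        rw [abs_div, abs_two]; linarith [abs_nonneg (h x)]
      exact (abs_sub _ _).trans (by linarith)
  · have : MemLp (fun x => 3 * |h x| + a) 2 P := (hh2.abs.const_mul 3).add (memLp_const a)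
    exact this.integrable_sq
  · refine ae_of_all _ fun x => ?_
    have h1 := (tendsto_mul_cexp_sub_one_sub ((h x / 2 : ℝ) : ℂ) ((a / 2 : ℝ) : ℂ))
    have h1' : Tendsto (fun n : ℕ => (n : ℝ) *
        (Real.exp ((h x / 2) / √n - (a / 2) / n) - 1 - (h x / 2) / √n)) atTop
        (𝓝 ((h x / 2) ^ 2 / 2 - a / 2)) := by
      have := (Complex.continuous_re.tendsto _).comp h1
      convert! this using 1
      · ext n
        simp only [Function.comp]
        rw [← Complex.ofReal_re (_ * _)]
        push_cast
        rfl
      · rw [← Complex.ofReal_re (_ - _)]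
        push_cast
        rfl
    have h2 : Tendsto (fun n : ℕ => (√n)⁻¹ * ((n : ℝ) *
        (Real.exp ((h x / 2) / √n - (a / 2) / n) - 1 - (h x / 2) / √n))) atTop (𝓝 0) := by
      simpa using (tendsto_inv_atTop_zero.comp hs).mul h1'
    have h3 := h2.pow 2
    rw [zero_pow two_ne_zero] at h3
    refine h3.congr' ?_
    filter_upwards [eventually_abs_le_sqrt (h x), eventually_gt_atTop 0] with n hn hn0
    rw [hroot hn, ← mul_assoc]
    congr 2
    have hs0 : 0 < √(n : ℝ) := Real.sqrt_pos.2 (by exact_mod_cast hn0)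
    rw [inv_mul_eq_div, div_eq_iff hs0.ne', Real.mul_self_sqrt (Nat.cast_nonneg n)]

end Expansion

section Product

variable {Ω : Type*} [MeasurableSpace Ω] {P : Measure Ω} [IsProbabilityMeasure P]

theorem pi_withDensity_ofReal {r : Ω → ℝ} (hr0 : ∀ x, 0 ≤ r x)
    (hri : Integrable r P) (n : ℕ) :
    Measure.pi (fun _ : Fin n => P.withDensity fun x => ENNReal.ofReal (r x)) =
      (Measure.pi fun _ : Fin n => P).withDensity fun x => ENNReal.ofReal (∏ i, r (x i)) := by
  have : IsFiniteMeasure (P.withDensity fun x => ENNReal.ofReal (r x)) :=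
    isFiniteMeasure_withDensity_ofReal hri.2
  refine Measure.pi_eq fun s hs => ?_
  rw [withDensity_apply _ (MeasurableSet.univ_pi hs), Measure.restrict_pi_pi,
    ← ofReal_integral_eq_lintegral_ofReal, integral_fintype_prod_eq_prod (f := fun _ => r),
    ENNReal.ofReal_prod_of_nonneg]
  · refine Finset.prod_congr rfl fun i _ => ?_
    rw [withDensity_apply _ (hs i), ofReal_integral_eq_lintegral_ofReal hri.restrict
      (ae_of_all _ hr0)]
  · exact fun i _ => integral_nonneg hr0
  · exact Integrable.fintype_prod_dep (f := fun _ => r) fun i => hri.restrict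
  · exact ae_of_all _ fun x => Finset.prod_nonneg fun i _ => hr0 _

theorem integral_prod_eq_pow (r : Ω → ℝ) (n : ℕ) :
    ∫ x, ∏ i, r (x i) ∂(Measure.pi fun _ : Fin n => P) = (∫ x, r x ∂P) ^ n := by
  rw [integral_fintype_prod_eq_prod (f := fun _ => r)]; simp

theorem norm_integral_pi_sub_integral_rnDeriv_le {Q : Measure Ω} [IsProbabilityMeasure Q] (n : ℕ)
    {f : (Fin n → Ω) → ℂ} (hf : Measurable f) (hf1 : ∀ x, ‖f x‖ ≤ 1) :
    ‖∫ x, f x ∂(Measure.pi fun _ : Fin n => Q) -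
        ∫ x, ((∏ i, (Q.rnDeriv P (x i)).toReal : ℝ) : ℂ) * f x ∂(Measure.pi fun _ : Fin n => P)‖
      ≤ 1 - (∫ x, (Q.rnDeriv P x).toReal ∂P) ^ n := by
  set r : Ω → ℝ := fun x => (Q.rnDeriv P x).toReal
  have hrm : Measurable r := (Measure.measurable_rnDeriv Q P).ennreal_toReal
  have hr0 : ∀ x, 0 ≤ r x := fun x => ENNReal.toReal_nonneg
  have hri : Integrable r P := Measure.integrable_toReal_rnDeriv
  obtain ⟨s, hs, hsQ, hsP⟩ := Measure.mutuallySingular_singularPart Q P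
  have hrest : Q.restrict s = P.withDensity fun x => ENNReal.ofReal (r x) := by
    have h1 : P.withDensity (fun x => ENNReal.ofReal (r x)) = P.withDensity (Q.rnDeriv P) := by
      refine withDensity_congr_ae ?_
      filter_upwards [Measure.rnDeriv_lt_top Q P] with x hx
      exact ENNReal.ofReal_toReal hx.ne
    have h2 : Q = Q.singularPart P + P.withDensity (Q.rnDeriv P) :=
      Measure.haveLebesgueDecomposition_add Q P
    rw [h1]
    conv_lhs => rw [h2]
    rw [Measure.restrict_add, Measure.restrict_eq_zero.2 hsQ, zero_add]
    refine Measure.restrict_eq_self_of_ae_mem ?_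
    refine (withDensity_absolutelyContinuous P _) ?_
    simpa using hsP
  have hQs : Q.real s = ∫ x, r x ∂P := by
    rw [integral_eq_lintegral_of_nonneg_ae (ae_of_all _ hr0) hrm.aestronglyMeasurable,
      Measure.real, ← Measure.restrict_apply_univ, hrest, withDensity_apply _ .univ,
      Measure.restrict_univ]
  set S : Set (Fin n → Ω) := Set.univ.pi fun _ => s with hS
  have hSm : MeasurableSet S := MeasurableSet.univ_pi fun _ => hs
  have hSQ : (Measure.pi fun _ : Fin n => Q).real S = (∫ x, r x ∂P) ^ n := by
    rw [Measure.real, hS, Measure.pi_pi]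
    simp [← hQs, Measure.real]
  have hfi : Integrable f (Measure.pi fun _ : Fin n => Q) :=
    Integrable.of_bound hf.aestronglyMeasurable 1 (ae_of_all _ hf1)
  have hpart : ∫ x in S, f x ∂(Measure.pi fun _ : Fin n => Q) =
      ∫ x, ((∏ i, r (x i) : ℝ) : ℂ) * f x ∂(Measure.pi fun _ : Fin n => P) := by
    rw [hS, Measure.restrict_pi_pi]
    simp_rw [hrest]
    rw [pi_withDensity_ofReal hr0 hri, integral_withDensity_eq_integral_toReal_smul
      (by fun_prop) (ae_of_all _ fun x => ENNReal.ofReal_lt_top)]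
    refine integral_congr_ae (ae_of_all _ fun x => ?_)
    simp only
    rw [ENNReal.toReal_ofReal (Finset.prod_nonneg fun i _ => hr0 _), Complex.real_smul]
  rw [← hpart, ← integral_add_compl hSm hfi, add_sub_cancel_left]
  calc _ ≤ 1 * (Measure.pi fun _ : Fin n => Q).real Sᶜ :=
        norm_setIntegral_le_of_norm_le_const (measure_lt_top _ _) fun x _ => hf1 x
    _ = 1 - (∫ x, r x ∂P) ^ n := by rw [one_mul, probReal_compl_eq_one_sub hSm, hSQ]

theorem integral_sub_sq_eq {X : Type*} [MeasurableSpace X] {ν : Measure X} {A B : X → ℝ}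
    (hA : MemLp A 2 ν) (hB : MemLp B 2 ν) :
    ∫ x, (A x - B x) ^ 2 ∂ν = ∫ x, A x ^ 2 ∂ν + ∫ x, B x ^ 2 ∂ν - 2 * ∫ x, A x * B x ∂ν := by
  have hAB : Integrable (fun x => 2 * (A x * B x)) ν := (hA.integrable_mul hB).const_mul 2
  have hs : Integrable (fun x => A x ^ 2 + B x ^ 2) ν := hA.integrable_sq.add hB.integrable_sq
  rw [← integral_const_mul, ← integral_add hA.integrable_sq hB.integrable_sq,
    ← integral_sub hs hAB]
  congr 1; ext x; ring

theorem integral_add_sq_eq {X : Type*} [MeasurableSpace X] {ν : Measure X} {A B : X → ℝ}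
    (hA : MemLp A 2 ν) (hB : MemLp B 2 ν) :
    ∫ x, (A x + B x) ^ 2 ∂ν = ∫ x, A x ^ 2 ∂ν + ∫ x, B x ^ 2 ∂ν + 2 * ∫ x, A x * B x ∂ν := by
  have := integral_sub_sq_eq hA hB.neg
  simpa [integral_neg] using this

theorem integral_abs_sq_sub_sq_le {X : Type*} [MeasurableSpace X] {ν : Measure X} {A B : X → ℝ}
    (hA : MemLp A 2 ν) (hB : MemLp B 2 ν) :
    ∫ x, |A x ^ 2 - B x ^ 2| ∂ν ≤
      √(∫ x, (A x - B x) ^ 2 ∂ν) * √(∫ x, (A x + B x) ^ 2 ∂ν) := by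
  have h := integral_mul_norm_le_Lp_mul_Lq (μ := ν) (f := fun x => A x - B x)
    (g := fun x => A x + B x) Real.HolderConjugate.two_two
    (by rw [ENNReal.ofReal_ofNat]; exact hA.sub hB) (by rw [ENNReal.ofReal_ofNat]; exact hA.add hB)
  simp only [Real.norm_eq_abs, ← abs_mul, Real.rpow_two, sq_abs, ← Real.sqrt_eq_rpow] at h
  refine le_trans (le_of_eq ?_) h
  congr 1; ext x; congr 1; ring

/-- Hellinger bound for the `L¹` distance of products of the densities `a²` and `b²`. -/
theorem integral_abs_prod_sq_sub_le {a b : Ω → ℝ} (ha : MemLp a 2 P) (hb : MemLp b 2 P) (n : ℕ) :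
    ∫ x, |∏ i, a (x i) ^ 2 - ∏ i, b (x i) ^ 2| ∂(Measure.pi fun _ : Fin n => P) ≤
      √((∫ x, a x ^ 2 ∂P) ^ n + (∫ x, b x ^ 2 ∂P) ^ n - 2 * (∫ x, a x * b x ∂P) ^ n) *
      √((∫ x, a x ^ 2 ∂P) ^ n + (∫ x, b x ^ 2 ∂P) ^ n + 2 * (∫ x, a x * b x ∂P) ^ n) := by
  have hprod : ∀ {c : Ω → ℝ}, MemLp c 2 P →
      MemLp (fun x : Fin n → Ω => ∏ i, c (x i)) 2 (Measure.pi fun _ : Fin n => P) := by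
    intro c hc
    have h1 : Integrable (fun x : Fin n → Ω => ∏ i, c (x i)) (Measure.pi fun _ : Fin n => P) :=
      Integrable.fintype_prod_dep (f := fun _ => c) fun _ => hc.integrable one_le_two
    rw [memLp_two_iff_integrable_sq h1.aestronglyMeasurable]
    simp_rw [← Finset.prod_pow]
    exact Integrable.fintype_prod_dep (f := fun _ x => c x ^ 2) fun _ => hc.integrable_sq
  have hA := hprod ha
  have hB := hprod hb
  have iA : ∫ x, (∏ i, a (x i)) ^ 2 ∂(Measure.pi fun _ : Fin n => P) = (∫ x, a x ^ 2 ∂P) ^ n := by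
    simp_rw [← Finset.prod_pow]; exact integral_prod_eq_pow (fun x => a x ^ 2) n
  have iB : ∫ x, (∏ i, b (x i)) ^ 2 ∂(Measure.pi fun _ : Fin n => P) = (∫ x, b x ^ 2 ∂P) ^ n := by
    simp_rw [← Finset.prod_pow]; exact integral_prod_eq_pow (fun x => b x ^ 2) n
  have iAB : ∫ x, (∏ i, a (x i)) * (∏ i, b (x i)) ∂(Measure.pi fun _ : Fin n => P) =
      (∫ x, a x * b x ∂P) ^ n := by
    simp_rw [← Finset.prod_mul_distrib]; exact integral_prod_eq_pow (fun x => a x * b x) n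
  have h := integral_abs_sq_sub_sq_le hA hB
  rw [integral_sub_sq_eq hA hB, integral_add_sq_eq hA hB, iA, iB, iAB] at h
  simpa only [Finset.prod_pow] using h

end Product

section Approximation

variable {Ω : Type*} [MeasurableSpace Ω] {P : Measure Ω} [IsProbabilityMeasure P]
  {h : Ω → ℝ} {a : ℝ} {Q : ℕ → Measure Ω}

theorem memLp_sqrt_rnDeriv {μ : Measure Ω} (ν : Measure Ω) [IsProbabilityMeasure ν] :
    MemLp (fun x => √(ν.rnDeriv μ x).toReal) 2 μ := by
  rw [memLp_two_iff_integrable_sq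
    (Measure.measurable_rnDeriv ν μ).ennreal_toReal.sqrt.aestronglyMeasurable]
  simp_rw [Real.sq_sqrt ENNReal.toReal_nonneg]
  exact Measure.integrable_toReal_rnDeriv

theorem memLp_sqrt_truncTilt (hh : Measurable h) (n : ℕ) :
    MemLp (fun x => √(truncTilt h a n x)) 2 P := by
  rw [memLp_two_iff_integrable_sq ((measurable_truncTilt hh n).sqrt).aestronglyMeasurable]
  simp_rw [Real.sq_sqrt (truncTilt_nonneg n _)]
  exact integrable_truncTilt hh n

theorem tendsto_pow_of_mul_sub_one {m : ℕ → ℝ}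
    (hm : Tendsto (fun n : ℕ => (n : ℝ) * (m n - 1)) atTop (𝓝 0)) :
    Tendsto (fun n : ℕ => m n ^ n) atTop (𝓝 1) := by
  simpa using Real.tendsto_one_add_pow_exp_of_tendsto hm

variable [∀ n, IsProbabilityMeasure (Q n)]

theorem tendsto_mul_integral_rnDeriv_sub_one
    (hQ : Tendsto (fun n : ℕ => (n : ℝ) * sqrtDistSq P (Q n) (fun x => 1 + h x / (2 * √n)))
      atTop (𝓝 0)) :
    Tendsto (fun n : ℕ => (n : ℝ) * (∫ x, ((Q n).rnDeriv P x).toReal ∂P - 1)) atTop (𝓝 0) := by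
  rw [← neg_zero, ← tendsto_neg_iff]
  simp only [neg_neg]
  refine squeeze_zero (fun n => ?_) (fun n => ?_) hQ
  all_goals rw [Measure.integral_toReal_rnDeriv', probReal_univ]
  · have := measureReal_nonneg (μ := (Q n).singularPart P) (s := Set.univ)
    nlinarith [(Nat.cast_nonneg n : (0 : ℝ) ≤ n)]
  · have h1 : 0 ≤ ∫ x, (√((Q n).rnDeriv P x).toReal - (1 + h x / (2 * √n))) ^ 2 ∂P :=
      integral_nonneg fun x => sq_nonneg _
    unfold sqrtDistSq
    nlinarith [(Nat.cast_nonneg n : (0 : ℝ) ≤ n)]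

theorem tendsto_mul_integral_sqrt_sub_sq (hh : Measurable h) (hh2 : MemLp h 2 P) (ha : 0 ≤ a)
    (hQ : Tendsto (fun n : ℕ => (n : ℝ) * sqrtDistSq P (Q n) (fun x => 1 + h x / (2 * √n)))
      atTop (𝓝 0)) :
    Tendsto (fun n : ℕ => (n : ℝ) *
      ∫ x, (√((Q n).rnDeriv P x).toReal - √(truncTilt h a n x)) ^ 2 ∂P) atTop (𝓝 0) := by
  have h1 := (hQ.add (tendsto_integral_sqrt_truncTilt_sub_sq hh hh2 ha)).const_mul 2
  rw [add_zero, mul_zero] at h1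
  refine squeeze_zero (fun n => ?_) (fun n => ?_) h1
  · exact mul_nonneg (Nat.cast_nonneg n) (integral_nonneg fun x => sq_nonneg _)
  have hl : MemLp (fun x => 1 + h x / (2 * √n)) 2 P := by
    simp_rw [div_eq_inv_mul]
    exact (memLp_const (1 : ℝ)).add (hh2.const_mul (2 * √n)⁻¹)
  have hA : Integrable (fun x => (√((Q n).rnDeriv P x).toReal - (1 + h x / (2 * √n))) ^ 2) P :=
    ((memLp_sqrt_rnDeriv (μ := P) (Q n)).sub hl).integrable_sq
  have hB : Integrable (fun x => (√(truncTilt h a n x) - (1 + h x / (2 * √n))) ^ 2) P :=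
    ((memLp_sqrt_truncTilt (P := P) (a := a) hh n).sub hl).integrable_sq
  have hs : 0 ≤ ((Q n).singularPart P).real Set.univ := measureReal_nonneg
  have hle : ∫ x, (√((Q n).rnDeriv P x).toReal - √(truncTilt h a n x)) ^ 2 ∂P ≤
      2 * (∫ x, (√((Q n).rnDeriv P x).toReal - (1 + h x / (2 * √n))) ^ 2 ∂P +
        ∫ x, (√(truncTilt h a n x) - (1 + h x / (2 * √n))) ^ 2 ∂P) := by
    rw [← integral_add hA hB, ← integral_const_mul]
    refine integral_mono ((memLp_sqrt_rnDeriv (Q n)).sub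
      (memLp_sqrt_truncTilt hh n)).integrable_sq
      ((hA.add hB).const_mul 2) fun x => ?_
    nlinarith [sq_nonneg ((√((Q n).rnDeriv P x).toReal - (1 + h x / (2 * √n))) +
      (√(truncTilt h a n x) - (1 + h x / (2 * √n))))]
  unfold sqrtDistSq
  nlinarith [(Nat.cast_nonneg n : (0 : ℝ) ≤ n)]

/-- The product densities of the local sequence and of the tilted measures merge in `L¹(Pⁿ)`. -/
theorem tendsto_integral_abs_prod_sub (hh : Measurable h) (hh2 : MemLp h 2 P)
    (hh0 : ∫ x, h x ∂P = 0) (ha : a = (∫ x, h x ^ 2 ∂P) / 2)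
    (hQ : Tendsto (fun n : ℕ => (n : ℝ) * sqrtDistSq P (Q n) (fun x => 1 + h x / (2 * √n)))
      atTop (𝓝 0)) :
    Tendsto (fun n : ℕ => ∫ x, |∏ i, ((Q n).rnDeriv P (x i)).toReal -
      ∏ i, truncTilt h a n (x i)| ∂(Measure.pi fun _ : Fin n => P)) atTop (𝓝 0) := by
  have ha0 : 0 ≤ a := by
    have : 0 ≤ ∫ x, h x ^ 2 ∂P := integral_nonneg fun x => sq_nonneg _
    linarith
  have hq := tendsto_mul_integral_rnDeriv_sub_one hQ
  have hw := tendsto_integral_truncTilt hh hh2 hh0 ha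
  have hd := tendsto_mul_integral_sqrt_sub_sq hh hh2 ha0 hQ
  have hc : Tendsto (fun n : ℕ => (n : ℝ) *
      (∫ x, √((Q n).rnDeriv P x).toReal * √(truncTilt h a n x) ∂P - 1)) atTop (𝓝 0) := by
    have := ((hq.add hw).sub hd).div_const 2
    simp only [add_zero, sub_zero, zero_div] at this
    refine this.congr fun n => ?_
    have hA := memLp_sqrt_rnDeriv (μ := P) (Q n)
    have hB := memLp_sqrt_truncTilt (P := P) (a := a) hh n
    rw [integral_sub_sq_eq hA hB]
    simp_rw [Real.sq_sqrt ENNReal.toReal_nonneg, Real.sq_sqrt (truncTilt_nonneg n _)]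
    ring
  have pq := tendsto_pow_of_mul_sub_one hq
  have pw := tendsto_pow_of_mul_sub_one hw
  have pc := tendsto_pow_of_mul_sub_one hc
  have hlim := (((pq.add pw).sub (pc.const_mul 2)).sqrt).mul
    (((pq.add pw).add (pc.const_mul 2)).sqrt)
  norm_num at hlim
  refine squeeze_zero (fun n => integral_nonneg fun x => abs_nonneg _) (fun n => ?_) hlim
  have := integral_abs_prod_sq_sub_le (memLp_sqrt_rnDeriv (μ := P) (Q n))
    (memLp_sqrt_truncTilt (P := P) (a := a) hh n) n
  simp_rw [Real.sq_sqrt ENNReal.toReal_nonneg, Real.sq_sqrt (truncTilt_nonneg n _)] at this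
  exact this

/-- Integrals of uniformly bounded functions under the local sequence are approximated by
integrals with respect to the tilted densities. -/
theorem tendsto_integral_pi_sub (hh : Measurable h) (hh2 : MemLp h 2 P)
    (hh0 : ∫ x, h x ∂P = 0) (ha : a = (∫ x, h x ^ 2 ∂P) / 2)
    (hQ : Tendsto (fun n : ℕ => (n : ℝ) * sqrtDistSq P (Q n) (fun x => 1 + h x / (2 * √n)))
      atTop (𝓝 0)) {f : ∀ n : ℕ, (Fin n → Ω) → ℂ} (hf : ∀ n, Measurable (f n))
    (hf1 : ∀ n x, ‖f n x‖ ≤ 1) :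
    Tendsto (fun n : ℕ => ∫ x, f n x ∂(Measure.pi fun _ : Fin n => Q n) -
      ∫ x, ((∏ i, truncTilt h a n (x i) : ℝ) : ℂ) * f n x ∂(Measure.pi fun _ : Fin n => P)) atTop
      (𝓝 0) := by
  have h1 := (tendsto_pow_of_mul_sub_one (tendsto_mul_integral_rnDeriv_sub_one hQ)).const_sub 1
  have h2 := h1.add (tendsto_integral_abs_prod_sub hh hh2 hh0 ha hQ)
  rw [sub_self, add_zero] at h2
  refine squeeze_zero_norm (fun n => ?_) h2
  have hbd := norm_integral_pi_sub_integral_rnDeriv_le (P := P) (Q := Q n) n (hf n) (hf1 n)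
  have iq : Integrable (fun x : Fin n → Ω => ∏ i, ((Q n).rnDeriv P (x i)).toReal)
      (Measure.pi fun _ : Fin n => P) :=
    Integrable.fintype_prod_dep (f := fun _ x => ((Q n).rnDeriv P x).toReal)
      fun _ => Measure.integrable_toReal_rnDeriv
  have iw : Integrable (fun x : Fin n → Ω => ∏ i, truncTilt h a n (x i))
      (Measure.pi fun _ : Fin n => P) :=
    Integrable.fintype_prod_dep (f := fun _ => truncTilt h a n) fun _ => integrable_truncTilt hh n
  have iqf : Integrable (fun x => ((∏ i, ((Q n).rnDeriv P (x i)).toReal : ℝ) : ℂ) * f n x)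
      (Measure.pi fun _ : Fin n => P) :=
    iq.ofReal (𝕜 := ℂ) |>.mul_bdd (c := 1) (hf n).aestronglyMeasurable (ae_of_all _ (hf1 n))
  have iwf : Integrable (fun x => ((∏ i, truncTilt h a n (x i) : ℝ) : ℂ) * f n x)
      (Measure.pi fun _ : Fin n => P) :=
    iw.ofReal (𝕜 := ℂ) |>.mul_bdd (c := 1) (hf n).aestronglyMeasurable (ae_of_all _ (hf1 n))
  have hbd2 : ‖∫ x, ((∏ i, ((Q n).rnDeriv P (x i)).toReal : ℝ) : ℂ) * f n x
        ∂(Measure.pi fun _ : Fin n => P) -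
      ∫ x, ((∏ i, truncTilt h a n (x i) : ℝ) : ℂ) * f n x ∂(Measure.pi fun _ : Fin n => P)‖ ≤
      ∫ x, |∏ i, ((Q n).rnDeriv P (x i)).toReal - ∏ i, truncTilt h a n (x i)|
        ∂(Measure.pi fun _ : Fin n => P) := by
    rw [← integral_sub iqf iwf]
    refine norm_integral_le_of_norm_le (iq.sub iw).abs (ae_of_all _ fun x => ?_)
    rw [← sub_mul, norm_mul, ← Complex.ofReal_sub, Complex.norm_real, Real.norm_eq_abs]
    exact mul_le_of_le_one_right (abs_nonneg _) (hf1 n x)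
  calc _ = ‖(_ - ∫ x, ((∏ i, ((Q n).rnDeriv P (x i)).toReal : ℝ) : ℂ) * f n x
        ∂(Measure.pi fun _ : Fin n => P)) + (∫ x, ((∏ i, ((Q n).rnDeriv P (x i)).toReal : ℝ) : ℂ) *
          f n x ∂(Measure.pi fun _ : Fin n => P) - _)‖ := by rw [sub_add_sub_cancel]
    _ ≤ _ := (norm_add_le _ _).trans (add_le_add hbd hbd2)

end Approximation

section LimitLaw

theorem sumTest_eq_indicator {Ω : Type*} (k : Ω → ℝ) (b : ℝ) (n : ℕ) :
    sumTest k b n = Set.indicator {x | b < (√n)⁻¹ * ∑ i, k (x i)} 1 := by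
  ext x
  simp only [sumTest, Set.indicator, Set.mem_ofPred_eq, Pi.one_apply]

theorem stdNormalCDF_eq_gaussianReal_Ioi {σ : ℝ} (hσ : 0 < σ) (m u : ℝ) :
    (gaussianReal m (NNReal.mk (σ ^ 2) (sq_nonneg σ))).real (Set.Ioi (σ * u)) =
      stdNormalCDF (-u + m / σ) := by
  have h1 : gaussianReal m (NNReal.mk (σ ^ 2) (sq_nonneg σ)) =
      (gaussianReal 0 1).map (fun x => m + -σ * x) := by
    have h2 : (fun x : ℝ => m + -σ * x) = (fun x => m + x) ∘ (fun x => -σ * x) := rfl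
    rw [h2, ← Measure.map_map (by fun_prop) (by fun_prop), gaussianReal_map_const_mul,
      gaussianReal_map_const_add]
    congr 1
    · ring
    · ext; simp
  rw [h1, stdNormalCDF, cdf_eq_real, map_measureReal_apply (by fun_prop) measurableSet_Ioi]
  have h3 : (fun x => m + -σ * x) ⁻¹' Set.Ioi (σ * u) = Set.Iio (-u + m / σ) := by
    ext x
    simp only [Set.mem_preimage, Set.mem_Ioi, Set.mem_Iio]
    rw [← sub_pos, ← sub_pos (b := x), show m + -σ * x - σ * u = σ * (-u + m / σ - x) by
      field_simp; ring]
    exact mul_pos_iff_of_pos_left hσ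
  rw [h3]
  have := nullSingletonClass_gaussianReal (μ := 0) (v := 1) one_ne_zero
  exact measureReal_congr Iio_ae_eq_Iic

variable {Ω : Type*} [MeasurableSpace Ω] {P : Measure Ω} [IsProbabilityMeasure P]
  {h k : Ω → ℝ} {Q : ℕ → Measure Ω} [∀ n, IsProbabilityMeasure (Q n)]

theorem tendsto_charFun_normalized_sum (hh : Measurable h) (hk : Measurable k)
    (hh2 : MemLp h 2 P) (hk2 : MemLp k 2 P) (hh0 : ∫ x, h x ∂P = 0) (hk0 : ∫ x, k x ∂P = 0)
    (hQ : Tendsto (fun n : ℕ => (n : ℝ) * sqrtDistSq P (Q n) (fun x => 1 + h x / (2 * √n)))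
      atTop (𝓝 0)) (u : ℝ) :
    Tendsto (fun n : ℕ => charFun ((Measure.pi fun _ : Fin n => Q n).map
      fun x => (√n)⁻¹ * ∑ i, k (x i)) u) atTop
      (𝓝 (Complex.exp (u * ((∫ x, k x * h x ∂P : ℝ) : ℂ) * Complex.I -
        ((∫ x, k x ^ 2 ∂P : ℝ) : ℂ) * u ^ 2 / 2))) := by
  set a : ℝ := (∫ x, h x ^ 2 ∂P) / 2 with ha
  have ha0 : 0 ≤ a := by
    have : 0 ≤ ∫ x, h x ^ 2 ∂P := integral_nonneg fun x => sq_nonneg _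
    positivity
  have hexp : ∫ x, ((u * k x * Complex.I + h x) ^ 2 / 2 - a : ℂ) ∂P =
      u * ((∫ x, k x * h x ∂P : ℝ) : ℂ) * Complex.I -
        ((∫ x, k x ^ 2 ∂P : ℝ) : ℂ) * u ^ 2 / 2 := by
    have ikh : Integrable (fun x => k x * h x) P := hk2.integrable_mul hh2
    have e : ∀ x, ((u * k x * Complex.I + h x) ^ 2 / 2 - a : ℂ) =
        ((h x ^ 2 / 2 - u ^ 2 / 2 * k x ^ 2 - a : ℝ) : ℂ) +
          ((k x * h x : ℝ) : ℂ) * (u * Complex.I) := fun x => by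
      push_cast
      linear_combination (u ^ 2 * k x ^ 2 / 2 : ℂ) * Complex.I_sq
    have i1 : Integrable (fun x => h x ^ 2 / 2 - u ^ 2 / 2 * k x ^ 2) P :=
      (hh2.integrable_sq.div_const 2).sub (hk2.integrable_sq.const_mul _)
    have i2 : Integrable (fun x => h x ^ 2 / 2 - u ^ 2 / 2 * k x ^ 2 - a) P :=
      i1.sub (integrable_const a)
    simp_rw [e]
    rw [integral_add i2.ofReal (ikh.ofReal.mul_const _), integral_mul_const,
      integral_complex_ofReal, integral_complex_ofReal, integral_sub i1 (integrable_const a),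
      integral_sub (hh2.integrable_sq.div_const 2) (hk2.integrable_sq.const_mul _),
      integral_div, integral_const_mul, ← ha]
    simp only [integral_const, probReal_univ, one_smul]
    push_cast
    ring
  have hmain := Complex.tendsto_one_add_pow_exp_of_tendsto
    (tendsto_integral_cexp_mul_truncTilt hh hk hh2 hk2 hh0 hk0 ha0 u)
  rw [hexp] at hmain
  have happ := tendsto_integral_pi_sub (f := fun n x =>
    Complex.exp (u * ((√n)⁻¹ * ∑ i, k (x i) : ℝ) * Complex.I)) hh hh2 hh0 ha hQ
    (fun n => by fun_prop) (fun n x => by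
      rw [← Complex.ofReal_mul, Complex.norm_exp_ofReal_mul_I])
  have hsum := happ.add hmain
  rw [zero_add] at hsum
  refine hsum.congr fun n => ?_
  have hm : Measurable fun x : Fin n → Ω => (√n)⁻¹ * ∑ i, k (x i) := by fun_prop
  rw [charFun_apply_real, integral_map hm.aemeasurable (by fun_prop), sub_add_eq_add_sub,
    sub_eq_iff_eq_add, add_sub_cancel]
  congr 1
  have := integral_fintype_prod_eq_prod (ι := Fin n) (μ := fun _ => P)
    (f := fun _ x => Complex.exp (u * k x * Complex.I / (√n : ℝ)) * truncTilt h a n x)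
  simp only [Finset.prod_const, Finset.card_univ, Fintype.card_fin] at this
  rw [← this]
  congr 1; ext x
  rw [Finset.prod_mul_distrib, ← Complex.exp_sum, mul_comm]
  push_cast
  congr 2
  rw [Finset.mul_sum, Finset.mul_sum, Finset.sum_mul]
  refine Finset.sum_congr rfl fun i _ => ?_
  ring

theorem tendsto_measureReal_normalized_sum_mem (hh : Measurable h) (hk : Measurable k)
    (hh2 : MemLp h 2 P) (hk2 : MemLp k 2 P) (hh0 : ∫ x, h x ∂P = 0) (hk0 : ∫ x, k x ∂P = 0)
    (hQ : Tendsto (fun n : ℕ => (n : ℝ) * sqrtDistSq P (Q n) (fun x => 1 + h x / (2 * √n)))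
      atTop (𝓝 0)) {σ : ℝ} (hσ : 0 < σ) (hkσ : ∫ x, k x ^ 2 ∂P = σ ^ 2) {E : Set ℝ}
    (hE : MeasurableSet E) (hEf : (frontier E).Countable) :
    Tendsto (fun n : ℕ => (Measure.pi fun _ : Fin n => Q n).real
      {x | (√n)⁻¹ * ∑ i, k (x i) ∈ E}) atTop
      (𝓝 ((gaussianReal (∫ x, k x * h x ∂P) (NNReal.mk (σ ^ 2) (sq_nonneg σ))).real E)) := by
  have hm : ∀ n : ℕ, Measurable fun x : Fin n → Ω => (√n)⁻¹ * ∑ i, k (x i) := fun n => by fun_prop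
  let μ : ℕ → ProbabilityMeasure ℝ := fun n => ⟨(Measure.pi fun _ : Fin n => Q n).map
      fun x => (√n)⁻¹ * ∑ i, k (x i), Measure.isProbabilityMeasure_map (hm n).aemeasurable⟩
  let ν : ProbabilityMeasure ℝ :=
    ⟨gaussianReal (∫ x, k x * h x ∂P) (NNReal.mk (σ ^ 2) (sq_nonneg σ)), inferInstance⟩
  have hlim : Tendsto μ atTop (𝓝 ν) := by
    refine ProbabilityMeasure.tendsto_iff_tendsto_charFun.2 fun u => ?_
    have := tendsto_charFun_normalized_sum hh hk hh2 hk2 hh0 hk0 hQ u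
    simp only [ν, μ, ProbabilityMeasure.coe_mk, charFun_gaussianReal]
    rw [hkσ] at this
    exact this
  have hv : NNReal.mk (σ ^ 2) (sq_nonneg σ) ≠ 0 := by
    intro h0
    have := congrArg NNReal.toReal h0
    simp [hσ.ne'] at this
  have := nullSingletonClass_gaussianReal (μ := ∫ x, k x * h x ∂P) hv
  have h0 : ν (frontier E) = 0 := by
    rw [ProbabilityMeasure.null_iff_toMeasure_null]
    exact hEf.measure_zero (gaussianReal _ _)
  have hE' := (NNReal.continuous_coe.tendsto _).comp
    (ProbabilityMeasure.tendsto_measure_of_null_frontier_of_tendsto hlim h0)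
  refine hE'.congr fun n => ?_
  change ((μ n : Measure ℝ) E).toReal = _
  simp only [μ, ProbabilityMeasure.coe_mk]
  rw [Measure.map_apply (hm n) hE]
  rfl

theorem integral_sumTest (hk : Measurable k) (b : ℝ) {n : ℕ} (μ : Measure (Fin n → Ω)) :
    ∫ x, sumTest k b n x ∂μ = μ.real {x | (√n)⁻¹ * ∑ i, k (x i) ∈ Set.Ioi b} := by
  rw [sumTest_eq_indicator]
  exact integral_indicator_one (measurableSet_lt measurable_const (by fun_prop))

/-- The asymptotic power of the test based on `k` along a local sequence with direction `h`. -/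
theorem tendsto_integral_sumTest (hh : Measurable h) (hk : Measurable k)
    (hh2 : MemLp h 2 P) (hk2 : MemLp k 2 P) (hh0 : ∫ x, h x ∂P = 0) (hk0 : ∫ x, k x ∂P = 0)
    (hQ : Tendsto (fun n : ℕ => (n : ℝ) * sqrtDistSq P (Q n) (fun x => 1 + h x / (2 * √n)))
      atTop (𝓝 0)) {σ : ℝ} (hσ : 0 < σ) (hkσ : ∫ x, k x ^ 2 ∂P = σ ^ 2) (u : ℝ) :
    Tendsto (fun n : ℕ => ∫ x, sumTest k (σ * u) n x ∂(Measure.pi fun _ : Fin n => Q n)) atTop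
      (𝓝 (stdNormalCDF (-u + (∫ x, k x * h x ∂P) / σ))) := by
  rw [← stdNormalCDF_eq_gaussianReal_Ioi hσ]
  simp_rw [integral_sumTest hk]
  exact tendsto_measureReal_normalized_sum_mem hh hk hh2 hk2 hh0 hk0 hQ hσ hkσ measurableSet_Ioi
    (by rw [frontier_Ioi]; exact Set.countable_singleton _)

theorem sqrtDistSq_self {μ : Measure Ω} [SigmaFinite μ] : sqrtDistSq μ μ (fun _ => 1) = 0 := by
  have : ∫ x, (√(μ.rnDeriv μ x).toReal - 1) ^ 2 ∂μ = 0 := by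
    refine integral_eq_zero_of_ae ?_
    filter_upwards [Measure.rnDeriv_self μ] with x hx
    simp [hx]
  simp [sqrtDistSq, Measure.singularPart_self, this]

end LimitLaw

section NeymanPearson

/-- The observations at which no factor of the product of the tilted densities is cut off. -/
def uncutSet {Ω : Type*} (h : Ω → ℝ) (n : ℕ) : Set (Fin n → Ω) :=
  Set.univ.pi fun _ => {x | |h x| ≤ √n}

section Pointwise

variable {Ω : Type*} {k : Ω → ℝ} {t a b : ℝ} {n : ℕ} {x : Fin n → Ω}

theorem prod_truncTilt_of_mem (hn : 0 < n) (hx : x ∈ uncutSet (fun y => t * k y) n) :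
    ∏ i, truncTilt (fun y => t * k y) a n (x i) =
      Real.exp (t * ((√n)⁻¹ * ∑ i, k (x i)) - a) := by
  have hn' : (n : ℝ) ≠ 0 := by exact_mod_cast hn.ne'
  have h1 : ∀ i, truncTilt (fun y => t * k y) a n (x i) =
      Real.exp (t * k (x i) / √n - a / n) := fun i => if_pos (hx i (Set.mem_univ i))
  simp_rw [h1]
  rw [← Real.exp_sum, Finset.sum_sub_distrib, ← Finset.sum_div, ← Finset.mul_sum]
  congr 1
  simp only [Finset.sum_const, Finset.card_univ, Fintype.card_fin, nsmul_eq_mul]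
  field_simp

theorem prod_truncTilt_of_notMem {h : Ω → ℝ} (hx : x ∉ uncutSet h n) :
    ∏ i, truncTilt h a n (x i) = 0 := by
  simp only [uncutSet, Set.mem_pi, not_forall] at hx
  obtain ⟨i, _, hi⟩ := hx
  exact Finset.prod_eq_zero (Finset.mem_univ i) (if_neg hi)

theorem sumTest_mem_Icc (k : Ω → ℝ) (b : ℝ) (n : ℕ) (x : Fin n → Ω) :
    sumTest k b n x ∈ Set.Icc (0 : ℝ) 1 := by
  unfold sumTest; split_ifs <;> simp

/-- Pointwise optimality of the likelihood ratio test with critical value `exp (t b - a)`. -/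
theorem mul_prod_truncTilt_sub_eq_abs (ht : 0 < t) (hn : 0 < n) {s : ℝ}
    (hs : s ∈ Set.Icc (0 : ℝ) 1) :
    ((uncutSet (fun y => t * k y) n).indicator (sumTest k b n) x - s) *
        (∏ i, truncTilt (fun y => t * k y) a n (x i) - Real.exp (t * b - a)) =
      |(uncutSet (fun y => t * k y) n).indicator (sumTest k b n) x - s| *
        |∏ i, truncTilt (fun y => t * k y) a n (x i) - Real.exp (t * b - a)| := by
  rw [← abs_mul, eq_comm, abs_eq_self]
  by_cases hx : x ∈ uncutSet (fun y => t * k y) n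
  · rw [Set.indicator_of_mem hx, prod_truncTilt_of_mem hn hx]
    unfold sumTest
    split_ifs with hb
    · refine mul_nonneg (by linarith [hs.2]) (sub_nonneg.2 (Real.exp_le_exp.2 ?_))
      nlinarith
    · refine mul_nonneg_of_nonpos_of_nonpos (by linarith [hs.1])
        (sub_nonpos.2 (Real.exp_le_exp.2 ?_))
      nlinarith
  · rw [Set.indicator_of_notMem hx, prod_truncTilt_of_notMem hx]
    nlinarith [hs.1, Real.exp_pos (t * b - a)]

theorem le_abs_prod_truncTilt_sub (ht : 0 < t) (hn : 0 < n)
    (hx : x ∈ uncutSet (fun y => t * k y) n) {δ : ℝ}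
    (hxb : (√n)⁻¹ * ∑ i, k (x i) ∉ Set.Icc (b - δ) (b + δ)) :
    Real.exp (t * b - a) * (1 - Real.exp (-(t * δ))) ≤
      |∏ i, truncTilt (fun y => t * k y) a n (x i) - Real.exp (t * b - a)| := by
  rw [prod_truncTilt_of_mem hn hx]
  set S := (√n)⁻¹ * ∑ i, k (x i)
  have e : Real.exp (t * S - a) = Real.exp (t * b - a) * Real.exp (t * (S - b)) := by
    rw [← Real.exp_add]; ring_nf
  rw [e, ← mul_sub_one, abs_mul, Real.abs_exp]
  refine mul_le_mul_of_nonneg_left ?_ (Real.exp_pos _).le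
  rw [Set.mem_Icc, not_and_or, not_le, not_le] at hxb
  rcases hxb with hb | hb
  · have : Real.exp (t * (S - b)) ≤ Real.exp (-(t * δ)) := Real.exp_le_exp.2 (by nlinarith)
    exact le_trans (by linarith) (neg_le_abs _)
  · have h1 : Real.exp (t * δ) ≤ Real.exp (t * (S - b)) := Real.exp_le_exp.2 (by nlinarith)
    have h2 := Real.add_one_le_exp (t * δ)
    have h3 := Real.add_one_le_exp (-(t * δ))
    exact le_trans (by linarith) (le_abs_self _)

end Pointwise

variable {Ω : Type*} [MeasurableSpace Ω] {P : Measure Ω} [IsProbabilityMeasure P] {h k : Ω → ℝ}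

theorem measurableSet_uncutSet (hh : Measurable h) (n : ℕ) : MeasurableSet (uncutSet h n) :=
  MeasurableSet.univ_pi fun _ => measurableSet_le (by fun_prop) measurable_const

theorem tendsto_measureReal_compl_uncutSet (hh : Measurable h) (hh2 : MemLp h 2 P) :
    Tendsto (fun n : ℕ => (Measure.pi fun _ : Fin n => P).real (uncutSet h n)ᶜ) atTop (𝓝 0) := by
  have hA : ∀ n : ℕ, MeasurableSet {x | |h x| ≤ √(n : ℝ)} := fun n =>
    measurableSet_le (by fun_prop) measurable_const
  have h1 : Tendsto (fun n : ℕ => ∫ x, (n : ℝ) *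
      (({x | |h x| ≤ √(n : ℝ)}.indicator 1 x : ℝ) - 1) ∂P) atTop (𝓝 (∫ _, (0 : ℝ) ∂P)) := by
    refine tendsto_integral_filter_of_dominated_convergence (fun x => h x ^ 2) ?_ ?_
      hh2.integrable_sq ?_
    · refine Eventually.of_forall fun n => Measurable.aestronglyMeasurable ?_
      exact ((measurable_one.indicator (hA n)).sub_const 1).const_mul _
    · refine Eventually.of_forall fun n => ae_of_all _ fun x => ?_
      by_cases hx : |h x| ≤ √(n : ℝ)
      · rw [Set.indicator_of_mem (by exact hx)]
        simpa using sq_nonneg (h x)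
      · rw [Set.indicator_of_notMem (by exact hx)]
        push Not at hx
        have := Real.lt_sq_of_sqrt_lt hx
        rw [sq_abs] at this
        simpa using this.le
    · refine ae_of_all _ fun x => tendsto_const_nhds.congr' ?_
      filter_upwards [eventually_abs_le_sqrt (h x)] with n hn
      rw [Set.indicator_of_mem (by exact hn)]
      simp
  have h2 : Tendsto (fun n : ℕ => (n : ℝ) * (P.real {x | |h x| ≤ √(n : ℝ)} - 1)) atTop (𝓝 0) := by
    rw [integral_zero] at h1
    refine h1.congr fun n => ?_
    rw [integral_const_mul, integral_sub ((integrable_const _).indicator (hA n))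
      (integrable_const _), integral_indicator_one (hA n)]
    simp
  have h3 := (tendsto_pow_of_mul_sub_one h2).const_sub 1
  rw [sub_self] at h3
  refine h3.congr fun n => ?_
  rw [probReal_compl_eq_one_sub (measurableSet_uncutSet hh n), uncutSet,
    Measure.real, Measure.real, Measure.pi_pi]
  simp

variable {Q : ℕ → Measure Ω} [∀ n, IsProbabilityMeasure (Q n)]

theorem tendsto_integral_test_sub (hh : Measurable h) (hh2 : MemLp h 2 P)
    (hh0 : ∫ x, h x ∂P = 0) {a : ℝ} (ha : a = (∫ x, h x ^ 2 ∂P) / 2)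
    (hQ : Tendsto (fun n : ℕ => (n : ℝ) * sqrtDistSq P (Q n) (fun x => 1 + h x / (2 * √n)))
      atTop (𝓝 0)) {τ : ∀ n : ℕ, (Fin n → Ω) → ℝ} (hτ : IsTestSeq τ) :
    Tendsto (fun n : ℕ => ∫ x, τ n x ∂(Measure.pi fun _ : Fin n => Q n) -
      ∫ x, (∏ i, truncTilt h a n (x i)) * τ n x ∂(Measure.pi fun _ : Fin n => P)) atTop
      (𝓝 0) := by
  have := tendsto_integral_pi_sub (f := fun n x => (τ n x : ℂ)) hh hh2 hh0 ha hQ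
    (fun n => Complex.measurable_ofReal.comp (hτ n).1) (fun n x => by
      rw [Complex.norm_real, Real.norm_of_nonneg ((hτ n).2 x).1]; exact ((hτ n).2 x).2)
  have h2 := (Complex.continuous_re.tendsto _).comp this
  refine h2.congr fun n => ?_
  simp only [Function.comp]
  simp_rw [← Complex.ofReal_mul]
  rw [integral_complex_ofReal, integral_complex_ofReal, ← Complex.ofReal_sub, Complex.ofReal_re]

theorem isTestSeq_sumTest (hk : Measurable k) (b : ℝ) : IsTestSeq (sumTest k b) := fun n => by
  refine ⟨?_, sumTest_mem_Icc k b n⟩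
  rw [sumTest_eq_indicator]
  exact measurable_one.indicator (measurableSet_lt measurable_const (by fun_prop))

theorem integrable_test {τ : ∀ n : ℕ, (Fin n → Ω) → ℝ} (hτ : IsTestSeq τ) {n : ℕ}
    (μ : Measure (Fin n → Ω)) [IsFiniteMeasure μ] : Integrable (τ n) μ :=
  Integrable.of_bound (hτ n).1.aestronglyMeasurable 1 (ae_of_all _ fun x => by
    rw [Real.norm_of_nonneg ((hτ n).2 x).1]; exact ((hτ n).2 x).2)

/-- The excess of the likelihood ratio test over `τ`, weighted by the distance of the likelihood
ratio to its critical value. -/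
noncomputable def excess (P : Measure Ω) (k : Ω → ℝ) (t a b : ℝ)
    (τ : ∀ n : ℕ, (Fin n → Ω) → ℝ) (n : ℕ) : ℝ :=
  ∫ x, |(uncutSet (fun y => t * k y) n).indicator (sumTest k b n) x - τ n x| *
    |∏ i, truncTilt (fun y => t * k y) a n (x i) - Real.exp (t * b - a)|
    ∂(Measure.pi fun _ : Fin n => P)

theorem excess_nonneg (μ : Measure Ω) (t a b : ℝ) (τ : ∀ n : ℕ, (Fin n → Ω) → ℝ) (n : ℕ) :
    0 ≤ excess μ k t a b τ n :=
  integral_nonneg fun _ => mul_nonneg (abs_nonneg _) (abs_nonneg _)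

variable {t a σ u : ℝ}

/-- Asymptotic Neyman-Pearson identity. -/
theorem tendsto_excess_add (hk : Measurable k) (hk2 : MemLp k 2 P) (hk0 : ∫ x, k x ∂P = 0)
    (hσ : 0 < σ) (hkσ : ∫ x, k x ^ 2 ∂P = σ ^ 2) (ht : 0 < t) (ha : a = t ^ 2 * σ ^ 2 / 2)
    (hQ : Tendsto (fun n : ℕ => (n : ℝ) * sqrtDistSq P (Q n) (fun x => 1 + t * k x / (2 * √n)))
      atTop (𝓝 0)) {τ : ∀ n : ℕ, (Fin n → Ω) → ℝ} (hτ : IsTestSeq τ) :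
    Tendsto (fun n : ℕ => excess P k t a (σ * u) τ n +
      (∫ x, τ n x ∂(Measure.pi fun _ : Fin n => Q n) -
        Real.exp (t * (σ * u) - a) * ∫ x, τ n x ∂(Measure.pi fun _ : Fin n => P))) atTop
      (𝓝 (stdNormalCDF (-u + t * σ) - Real.exp (t * (σ * u) - a) * stdNormalCDF (-u))) := by
  set h : Ω → ℝ := fun x => t * k x with hh_def
  have hh : Measurable h := hk.const_mul t
  have hh2 : MemLp h 2 P := hk2.const_mul t
  have hh0 : ∫ x, h x ∂P = 0 := by rw [integral_const_mul, hk0, mul_zero]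
  have hhsq : a = (∫ x, h x ^ 2 ∂P) / 2 := by
    simp_rw [hh_def, mul_pow]
    rw [integral_const_mul, hkσ, ha]
  have hkh : (∫ x, k x * h x ∂P) / σ = t * σ := by
    have : ∀ x, k x * h x = t * k x ^ 2 := fun x => by simp only [hh_def]; ring
    simp_rw [this]
    rw [integral_const_mul, hkσ]
    field_simp
  have hτt := isTestSeq_sumTest hk (σ * u)
  have f1 := tendsto_integral_sumTest hh hk hh2 hk2 hh0 hk0 hQ hσ hkσ u
  rw [hkh] at f1
  have f2 := tendsto_integral_test_sub hh hh2 hh0 hhsq hQ hτt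
  have f3 := tendsto_integral_test_sub hh hh2 hh0 hhsq hQ hτ
  have f4 : Tendsto (fun n : ℕ => ∫ x, sumTest k (σ * u) n x ∂(Measure.pi fun _ : Fin n => P))
      atTop (𝓝 (stdNormalCDF (-u))) := by
    have := tendsto_integral_sumTest (h := fun _ => (0 : ℝ)) (Q := fun _ => P) measurable_const hk
      (memLp_const 0) hk2 (by simp) hk0 (by simp [sqrtDistSq_self]) hσ hkσ u
    simpa using this
  have f5 : Tendsto (fun n : ℕ => ∫ x, (uncutSet h n).indicator (sumTest k (σ * u) n) x
      ∂(Measure.pi fun _ : Fin n => P)) atTop (𝓝 (stdNormalCDF (-u))) := by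
    have hd : Tendsto (fun n : ℕ => ∫ x, sumTest k (σ * u) n x ∂(Measure.pi fun _ : Fin n => P) -
        ∫ x, (uncutSet h n).indicator (sumTest k (σ * u) n) x ∂(Measure.pi fun _ : Fin n => P))
        atTop (𝓝 0) := by
      refine squeeze_zero_norm (fun n => ?_) (tendsto_measureReal_compl_uncutSet hh hh2)
      have hm := measurableSet_uncutSet hh n
      rw [integral_indicator hm, ← integral_add_compl hm (integrable_test hτt _),
        add_sub_cancel_left]
      refine (norm_setIntegral_le_of_norm_le_const (measure_lt_top _ _) fun x _ => ?_).trans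
        (one_mul _).le
      rw [Real.norm_of_nonneg (sumTest_mem_Icc k _ n x).1]
      exact (sumTest_mem_Icc k _ n x).2
    simpa using f4.sub hd
  have hmain := ((f1.sub f2).add f3).sub (f5.const_mul (Real.exp (t * (σ * u) - a)))
  rw [sub_zero, add_zero] at hmain
  refine hmain.congr' ?_
  filter_upwards [eventually_gt_atTop 0] with n hn
  have iw : Integrable (fun x : Fin n → Ω => ∏ i, truncTilt h a n (x i))
      (Measure.pi fun _ : Fin n => P) :=
    Integrable.fintype_prod_dep (f := fun _ => truncTilt h a n) fun _ => integrable_truncTilt hh n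
  have hbd : ∀ {τ : ∀ n : ℕ, (Fin n → Ω) → ℝ}, IsTestSeq τ →
      Integrable (fun x => (∏ i, truncTilt h a n (x i)) * τ n x)
        (Measure.pi fun _ : Fin n => P) := fun {τ} hτ =>
    iw.mul_bdd (c := 1) (hτ n).1.aestronglyMeasurable (ae_of_all _ fun x => by
      rw [Real.norm_of_nonneg ((hτ n).2 x).1]; exact ((hτ n).2 x).2)
  have i1 := hbd hτt
  have i2 := hbd hτ
  have i3 : Integrable (fun x => Real.exp (t * (σ * u) - a) *
      (uncutSet h n).indicator (sumTest k (σ * u) n) x) (Measure.pi fun _ : Fin n => P) :=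
    ((integrable_test hτt _).indicator (measurableSet_uncutSet hh n)).const_mul _
  have i4 : Integrable (fun x => Real.exp (t * (σ * u) - a) * τ n x)
      (Measure.pi fun _ : Fin n => P) := (integrable_test hτ _).const_mul _
  have hex : excess P k t a (σ * u) τ n =
      ∫ x, (∏ i, truncTilt h a n (x i)) * sumTest k (σ * u) n x ∂(Measure.pi fun _ : Fin n => P) -
      ∫ x, (∏ i, truncTilt h a n (x i)) * τ n x ∂(Measure.pi fun _ : Fin n => P) -
      (Real.exp (t * (σ * u) - a) * ∫ x, (uncutSet h n).indicator (sumTest k (σ * u) n) x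
        ∂(Measure.pi fun _ : Fin n => P) -
      Real.exp (t * (σ * u) - a) * ∫ x, τ n x ∂(Measure.pi fun _ : Fin n => P)) := by
    have i12 : Integrable (fun x => (∏ i, truncTilt h a n (x i)) * sumTest k (σ * u) n x -
      (∏ i, truncTilt h a n (x i)) * τ n x) (Measure.pi fun _ : Fin n => P) := i1.sub i2
    have i34 : Integrable (fun x => Real.exp (t * (σ * u) - a) *
      (uncutSet h n).indicator (sumTest k (σ * u) n) x - Real.exp (t * (σ * u) - a) * τ n x)
      (Measure.pi fun _ : Fin n => P) := i3.sub i4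
    rw [← integral_const_mul, ← integral_const_mul, ← integral_sub i1 i2, ← integral_sub i3 i4,
      ← integral_sub i12 i34]
    refine integral_congr_ae (ae_of_all _ fun x => ?_)
    simp only
    rw [← mul_prod_truncTilt_sub_eq_abs ht hn ((hτ n).2 x)]
    by_cases hx : x ∈ uncutSet h n
    · rw [Set.indicator_of_mem hx]; ring
    · rw [Set.indicator_of_notMem hx, prod_truncTilt_of_notMem hx]; ring
  rw [hex]
  ring

/-- If the excess vanishes asymptotically, then `τ` is asymptotically the likelihood ratio test. -/
theorem tendsto_measureReal_of_tendsto_excess (hk : Measurable k) (hk2 : MemLp k 2 P)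
    (hk0 : ∫ x, k x ∂P = 0) (hσ : 0 < σ) (hkσ : ∫ x, k x ^ 2 ∂P = σ ^ 2) (ht : 0 < t)
    {τ : ∀ n : ℕ, (Fin n → Ω) → ℝ} (hτ : IsTestSeq τ)
    (hex : Tendsto (excess P k t a (σ * u) τ) atTop (𝓝 0)) {ε : ℝ} (hε : 0 < ε) :
    Tendsto (fun n : ℕ => (Measure.pi fun _ : Fin n => P).real
      {x | ε ≤ |τ n x - sumTest k (σ * u) n x|}) atTop (𝓝 0) := by
  set h : Ω → ℝ := fun x => t * k x with hh_def
  have hh : Measurable h := hk.const_mul t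
  have hh2 : MemLp h 2 P := hk2.const_mul t
  have hτt := isTestSeq_sumTest hk (σ * u)
  set ν := gaussianReal 0 (NNReal.mk (σ ^ 2) (sq_nonneg σ))
  have hv : NNReal.mk (σ ^ 2) (sq_nonneg σ) ≠ 0 := by
    intro h0
    have := congrArg NNReal.toReal h0
    simp [hσ.ne'] at this
  have := nullSingletonClass_gaussianReal (μ := 0) hv
  refine tendsto_order.2 ⟨fun l hl => Eventually.of_forall fun n =>
    hl.trans_le measureReal_nonneg, fun l hl => ?_⟩
  obtain ⟨δ, hδl, hδ⟩ : ∃ δ : ℝ, ν.real (Set.Icc (σ * u - δ) (σ * u + δ)) < l / 3 ∧ 0 < δ := by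
    have h1 := tendsto_measure_Icc_nhdsWithin_right ν (σ * u)
    rw [measure_singleton] at h1
    have h2 := (ENNReal.tendsto_toReal ENNReal.zero_ne_top).comp h1
    have h3 := (h2.eventually_lt_const (show (0 : ENNReal).toReal < l / 3 by simp; positivity))
    exact ((h3.filter_mono (nhdsWithin_mono _ Set.Ioi_subset_Ici_self)).and
      self_mem_nhdsWithin).exists
  set η := Real.exp (t * (σ * u) - a) * (1 - Real.exp (-(t * δ))) with hη_def
  have hη : 0 < η := mul_pos (Real.exp_pos _) (sub_pos.2 (Real.exp_lt_one_iff.2 (by nlinarith)))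
  have e1 := (tendsto_measureReal_compl_uncutSet hh hh2).eventually_lt_const
    (show (0 : ℝ) < l / 3 by positivity)
  have e2 : ∀ᶠ n : ℕ in atTop, (Measure.pi fun _ : Fin n => P).real
      {x | (√n)⁻¹ * ∑ i, k (x i) ∈ Set.Icc (σ * u - δ) (σ * u + δ)} < l / 3 := by
    have h1 := tendsto_measureReal_normalized_sum_mem (h := fun _ => (0 : ℝ)) (Q := fun _ => P)
      measurable_const hk (memLp_const 0) hk2 (by simp) hk0 (by simp [sqrtDistSq_self]) hσ hkσ
      (measurableSet_Icc (a := σ * u - δ) (b := σ * u + δ))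
      (by rw [frontier_Icc (by linarith)]; exact (Set.toFinite _).countable)
    simp only [mul_zero, integral_zero] at h1
    exact h1.eventually_lt_const hδl
  have e3 := hex.eventually_lt_const (show (0 : ℝ) < ε * η * (l / 3) by positivity)
  filter_upwards [e1, e2, e3, eventually_gt_atTop 0] with n h1 h2 h3 hn
  set μ := Measure.pi fun _ : Fin n => P
  set F : (Fin n → Ω) → ℝ := fun x => |(uncutSet h n).indicator (sumTest k (σ * u) n) x - τ n x| *
    |∏ i, truncTilt h a n (x i) - Real.exp (t * (σ * u) - a)| with hF
  have hsub : {x | ε ≤ |τ n x - sumTest k (σ * u) n x|} ⊆ (uncutSet h n)ᶜ ∪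
      {x | (√n)⁻¹ * ∑ i, k (x i) ∈ Set.Icc (σ * u - δ) (σ * u + δ)} ∪ {x | ε * η ≤ F x} := by
    intro x hx
    by_cases hxA : x ∈ uncutSet h n
    · by_cases hxI : (√n)⁻¹ * ∑ i, k (x i) ∈ Set.Icc (σ * u - δ) (σ * u + δ)
      · exact Or.inl (Or.inr hxI)
      · refine Or.inr ?_
        have := le_abs_prod_truncTilt_sub (a := a) ht hn hxA hxI
        simp only [Set.mem_ofPred_eq, hF]
        rw [Set.indicator_of_mem hxA, abs_sub_comm]
        exact mul_le_mul hx this hη.le (abs_nonneg _)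
    · exact Or.inl (Or.inl hxA)
  have hFi : Integrable F μ := by
    have iw : Integrable (fun x : Fin n → Ω => ∏ i, truncTilt h a n (x i)) μ :=
      Integrable.fintype_prod_dep (f := fun _ => truncTilt h a n)
        fun _ => integrable_truncTilt hh n
    have i1 : Integrable (fun x => |∏ i, truncTilt h a n (x i) - Real.exp (t * (σ * u) - a)|) μ :=
      (iw.sub (integrable_const _)).abs
    refine i1.bdd_mul (c := 1) ?_ (ae_of_all _ fun x => ?_)
    · exact ((((hτt n).1.indicator (measurableSet_uncutSet hh n)).sub
        (hτ n).1).abs).aestronglyMeasurable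
    · rw [Real.norm_eq_abs, abs_abs]
      have h4 : (uncutSet h n).indicator (sumTest k (σ * u) n) x ∈ Set.Icc (0 : ℝ) 1 := by
        by_cases hx : x ∈ uncutSet h n
        · rw [Set.indicator_of_mem hx]; exact sumTest_mem_Icc k _ n x
        · rw [Set.indicator_of_notMem hx]; simp
      exact abs_sub_le_of_le_of_le h4.1 h4.2 ((hτ n).2 x).1 ((hτ n).2 x).2 |>.trans (by simp)
  have hmk := mul_meas_ge_le_integral_of_nonneg (μ := μ) (f := F)
    (ae_of_all _ fun x => mul_nonneg (abs_nonneg _) (abs_nonneg _)) hFi (ε * η)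
  have h5 : μ.real {x | ε * η ≤ F x} < l / 3 :=
    lt_of_mul_lt_mul_left (hmk.trans_lt h3) (by positivity)
  calc _ ≤ μ.real ((uncutSet h n)ᶜ ∪
      {x | (√n)⁻¹ * ∑ i, k (x i) ∈ Set.Icc (σ * u - δ) (σ * u + δ)} ∪ {x | ε * η ≤ F x}) :=
        measureReal_mono hsub
    _ ≤ μ.real ((uncutSet h n)ᶜ ∪
      {x | (√n)⁻¹ * ∑ i, k (x i) ∈ Set.Icc (σ * u - δ) (σ * u + δ)}) +
        μ.real {x | ε * η ≤ F x} := measureReal_union_le _ _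
    _ ≤ μ.real (uncutSet h n)ᶜ +
      μ.real {x | (√n)⁻¹ * ∑ i, k (x i) ∈ Set.Icc (σ * u - δ) (σ * u + δ)} +
        μ.real {x | ε * η ≤ F x} := by gcongr; exact measureReal_union_le _ _
    _ < l := by linarith

end NeymanPearson

section Limits

variable {d p q : ℕ → ℝ} {C α β : ℝ}

theorem isBoundedUnder_le_of_mem_Icc (hq : ∀ n, q n ∈ Set.Icc (0 : ℝ) 1) :
    IsBoundedUnder (· ≤ ·) atTop q := isBoundedUnder_of ⟨1, fun n => (hq n).2⟩

theorem isBoundedUnder_ge_of_mem_Icc (hq : ∀ n, q n ∈ Set.Icc (0 : ℝ) 1) :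
    IsBoundedUnder (· ≥ ·) atTop q := isBoundedUnder_of ⟨0, fun n => (hq n).1⟩

theorem limsup_le_of_tendsto_add (hd : ∀ n, 0 ≤ d n) (hC : 0 < C)
    (hp : ∀ n, p n ∈ Set.Icc (0 : ℝ) 1) (hq : ∀ n, q n ∈ Set.Icc (0 : ℝ) 1)
    (h : Tendsto (fun n => d n + (q n - C * p n)) atTop (𝓝 (β - C * α)))
    (hpα : limsup p atTop ≤ α) : limsup q atTop ≤ β := by
  refine le_of_forall_pos_le_add fun ε hε => ?_
  have e1 := h.eventually_lt_const (show β - C * α < β - C * α + ε / 2 by linarith)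
  have e2 := eventually_lt_of_limsup_lt (lt_of_le_of_lt hpα
    (show α < α + ε / (2 * C) by have : 0 < ε / (2 * C) := by positivity
                                 linarith)) (isBoundedUnder_le_of_mem_Icc hp)
  refine limsup_le_of_le (isBoundedUnder_ge_of_mem_Icc hq).isCoboundedUnder_le ?_
  filter_upwards [e1, e2] with n h1 h2
  have h3 : C * p n ≤ C * α + ε / 2 := by
    calc C * p n ≤ C * (α + ε / (2 * C)) := by gcongr
      _ = C * α + ε / 2 := by field_simp
  linarith [hd n]

theorem tendsto_zero_of_tendsto_add (hd : ∀ n, 0 ≤ d n) (hC : 0 < C)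
    (hp : ∀ n, p n ∈ Set.Icc (0 : ℝ) 1) (hq : ∀ n, q n ∈ Set.Icc (0 : ℝ) 1)
    (h : Tendsto (fun n => d n + (q n - C * p n)) atTop (𝓝 (β - C * α)))
    (hpα : limsup p atTop ≤ α) (hqβ : β ≤ liminf q atTop) : Tendsto d atTop (𝓝 0) := by
  refine tendsto_order.2 ⟨fun l hl => Eventually.of_forall fun n => hl.trans_le (hd n),
    fun ε hε => ?_⟩
  have e1 := h.eventually_lt_const (show β - C * α < β - C * α + ε / 3 by linarith)
  have e2 := eventually_lt_of_limsup_lt (lt_of_le_of_lt hpα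
    (show α < α + ε / (3 * C) by have : 0 < ε / (3 * C) := by positivity
                                 linarith)) (isBoundedUnder_le_of_mem_Icc hp)
  have e3 := eventually_lt_of_lt_liminf (lt_of_lt_of_le (show β - ε / 3 < β by linarith) hqβ)
    (isBoundedUnder_ge_of_mem_Icc hq)
  filter_upwards [e1, e2, e3] with n h1 h2 h3
  have h4 : C * p n ≤ C * α + ε / 3 := by
    calc C * p n ≤ C * (α + ε / (3 * C)) := by gcongr
      _ = C * α + ε / 3 := by field_simp
  linarith

theorem tendsto_div_sqrt_nhdsGT {t : ℝ} (ht : 0 < t) :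
    Tendsto (fun n : ℕ => t / √n) atTop (𝓝[>] 0) := by
  refine tendsto_nhdsWithin_iff.2 ⟨?_, ?_⟩
  · exact (Real.tendsto_sqrt_atTop.comp tendsto_natCast_atTop_atTop).const_div_atTop t
  · filter_upwards [eventually_gt_atTop 0] with n hn
    exact div_pos ht (Real.sqrt_pos.2 (by exact_mod_cast hn))

end Limits

section Geometry

variable {E : Type*} [NormedAddCommGroup E] [InnerProductSpace ℝ E] {G : Set E} {κ κt : E}

theorem IsConeProjection.mem_and_inner_le (hG : IsClosedConvexCone G)
    (hκ : IsConeProjection G κ κt) :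
    κt ∈ G ∧ (∀ g ∈ G, inner ℝ κ g ≤ inner ℝ κt g) ∧ inner ℝ κ κt = ‖κt‖ ^ 2 := by
  obtain ⟨⟨g₀, hg₀⟩, hcl, hcone⟩ := hG
  obtain ⟨hmem, hmin⟩ := hκ
  rw [hcl.closure_eq] at hmem hmin
  have hconv : Convex ℝ G := fun x hx y hy a b ha hb _ => hcone x hx y hy a b ha hb
  have hinf : ‖κ - κt‖ = ⨅ w : G, ‖κ - w‖ := by
    have : Nonempty G := ⟨⟨κt, hmem⟩⟩
    refine le_antisymm (le_ciInf fun w => hmin w w.2) ?_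
    exact ciInf_le (f := fun w : G => ‖κ - w‖) ⟨0, by rintro _ ⟨w, rfl⟩; exact norm_nonneg _⟩
      ⟨κt, hmem⟩
  have hvar := (norm_eq_iInf_iff_real_inner_le_zero hconv hmem).1 hinf
  refine ⟨hmem, fun g hg => ?_, ?_⟩
  · have := hvar (κt + g) (by simpa using hcone κt hmem g hg 1 1 zero_le_one zero_le_one)
    rw [add_sub_cancel_left, inner_sub_left] at this
    linarith
  · have h1 := hvar (0 : E) (by simpa using hcone κt hmem κt hmem 0 0 le_rfl le_rfl)
    have h2 := hvar (κt + κt) (by simpa using hcone κt hmem κt hmem 1 1 zero_le_one zero_le_one)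
    rw [zero_sub, inner_neg_right, inner_sub_left, real_inner_self_eq_norm_sq] at h1
    rw [add_sub_cancel_left, inner_sub_left, real_inner_self_eq_norm_sq] at h2
    linarith

theorem linProjection_mem_and_inner_eq [CompleteSpace E] (hG : IsClosedLinear G) (κ : E) :
    linProjection G κ ∈ G ∧ (∀ g ∈ G, inner ℝ κ g = inner ℝ (linProjection G κ) g) := by
  obtain ⟨hcl, V, rfl⟩ := hG
  have hV : ((Submodule.span ℝ (V : Set E)).topologicalClosure : Set E) = V := by
    rw [Submodule.span_eq, Submodule.topologicalClosure_coe, hcl.closure_eq]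
  refine ⟨?_, fun g hg => ?_⟩
  · exact hV.subset (Submodule.starProjection_apply_mem _ κ)
  · have hg' : g ∈ (Submodule.span ℝ (V : Set E)).topologicalClosure := hV.superset hg
    have := Submodule.starProjection_inner_eq_zero (𝕜 := ℝ) κ g hg'
    rw [inner_sub_left] at this
    exact sub_eq_zero.1 this

end Geometry

section Paths

variable {Ω : Type*} [MeasurableSpace Ω] {M : Set (ProbabilityMeasure Ω)}
  {P : ProbabilityMeasure Ω} {T : ProbabilityMeasure Ω → ℝ} {κ g : Lp ℝ 2 (P : Measure Ω)}
  {γ : ℝ → ProbabilityMeasure Ω} {t : ℝ}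

theorem IsLocalPath.tendsto_mul_sqrtDistSq (hγ : IsLocalPath M P g γ) (ht : 0 < t) {h : Ω → ℝ}
    (hh : h =ᵐ[(P : Measure Ω)] fun x => t * g x) :
    Tendsto (fun n : ℕ => (n : ℝ) * sqrtDistSq (P : Measure Ω) (γ (t / √n) : Measure Ω)
      (fun x => 1 + h x / (2 * √n))) atTop (𝓝 0) := by
  have h1 := (hγ.2.comp_tendsto (tendsto_div_sqrt_nhdsGT ht)).tendsto_div_nhds_zero.const_mul
    (t ^ 2)
  rw [mul_zero] at h1
  refine h1.congr' ?_
  filter_upwards [eventually_gt_atTop 0] with n hn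
  have hs : 0 < √(n : ℝ) := Real.sqrt_pos.2 (by exact_mod_cast hn)
  have e : sqrtDistSq (P : Measure Ω) (γ (t / √n) : Measure Ω) (fun x => 1 + h x / (2 * √n)) =
      sqrtDistSq (P : Measure Ω) (γ (t / √n) : Measure Ω) (fun x => 1 + t / √n / 2 * g x) := by
    unfold sqrtDistSq
    congr 1
    refine integral_congr_ae ?_
    filter_upwards [hh] with x hx
    rw [hx]
    congr 3
    field_simp
  rw [e]
  simp only [Function.comp]
  rw [div_pow, Real.sq_sqrt (Nat.cast_nonneg n)]
  field_simp

theorem IsDifferentiableFunctional.tendsto (hT : IsDifferentiableFunctional M P T κ)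
    (hg : g ∈ tangentSet M P) (hγ : IsLocalPath M P g γ) (ht : 0 < t) :
    Tendsto (fun n : ℕ => √n * (T (γ (t / √n)) - T P)) atTop (𝓝 (t * inner ℝ κ g)) := by
  have h1 := (((hT g hg γ hγ).comp_tendsto
    (tendsto_div_sqrt_nhdsGT ht)).tendsto_div_nhds_zero.const_mul t).add_const (t * inner ℝ κ g)
  rw [mul_zero, zero_add] at h1
  refine h1.congr' ?_
  filter_upwards [eventually_gt_atTop 0] with n hn
  have hs : 0 < √(n : ℝ) := Real.sqrt_pos.2 (by exact_mod_cast hn)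
  simp only [Function.comp]
  field_simp
  ring

theorem integral_test_mem_Icc {τ : ∀ n : ℕ, (Fin n → Ω) → ℝ} (hτ : IsTestSeq τ)
    (Q : ℕ → ProbabilityMeasure Ω) (n : ℕ) :
    ∫ x, τ n x ∂(iid (Q n) n) ∈ Set.Icc (0 : ℝ) 1 := by
  unfold iid
  refine ⟨integral_nonneg fun x => ((hτ n).2 x).1, ?_⟩
  calc _ ≤ ∫ _, (1 : ℝ) ∂(Measure.pi fun _ : Fin n => (Q n : Measure Ω)) :=
        integral_mono (integrable_test hτ _) (integrable_const _) fun x => ((hτ n).2 x).2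
    _ = 1 := by simp

theorem limsupPower_nonneg {τ : ∀ n : ℕ, (Fin n → Ω) → ℝ} (hτ : IsTestSeq τ)
    (Q : ℕ → ProbabilityMeasure Ω) : 0 ≤ limsupPower τ Q :=
  le_limsup_of_frequently_le
    (Eventually.of_forall fun n => (integral_test_mem_Icc hτ Q n).1).frequently
    (isBoundedUnder_le_of_mem_Icc (integral_test_mem_Icc hτ Q))

theorem liminfPower_nonneg {τ : ∀ n : ℕ, (Fin n → Ω) → ℝ} (hτ : IsTestSeq τ)
    (Q : ℕ → ProbabilityMeasure Ω) : 0 ≤ liminfPower τ Q :=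
  le_liminf_of_le (isBoundedUnder_le_of_mem_Icc
    (integral_test_mem_Icc hτ Q)).isCoboundedUnder_ge
    (Eventually.of_forall fun n => (integral_test_mem_Icc hτ Q n).1)

end Paths

end OneSidedTesting

theorem mainTheorem8 {Ω : Type*} [MeasurableSpace Ω]
    (M : Set (ProbabilityMeasure Ω)) (P : ProbabilityMeasure Ω) (hP : P ∈ M)
    (T : ProbabilityMeasure Ω → ℝ) (κ κt : Lp ℝ 2 (P : Measure Ω))
    (hT : OneSidedTesting.IsDifferentiableFunctional M P T κ)
    (hκt :
      (OneSidedTesting.IsClosedConvexCone (OneSidedTesting.tangentSet M P) ∧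
        OneSidedTesting.IsConeProjection (OneSidedTesting.tangentSet M P) κ κt) ∨
      (OneSidedTesting.IsClosedLinear (OneSidedTesting.tangentSet M P) ∧
        κt = OneSidedTesting.linProjection (OneSidedTesting.tangentSet M P) κ))
    (hκt0 : κt ≠ 0)
    (α : ℝ) (hα0 : 0 < α) (hα1 : α < 1)
    (u : ℝ) (hu : OneSidedTesting.stdNormalCDF (-u) = α)
    (c : ℝ) (hc : 0 < c)
    -- the tests `1{ n^{-1/2} ∑ κt(x_i) > ‖κt‖ u }`, for any measurable version `k` of `κt`
    (k : Ω → ℝ) (hk : Measurable k) (hkκ : k =ᵐ[(P : Measure Ω)] κt)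
    (τt : ∀ n : ℕ, (Fin n → Ω) → ℝ) (hτt : τt = OneSidedTesting.sumTest k (‖κt‖ * u)) :
    -- `K` is nonempty, so that the infima over `K` are genuine
    (OneSidedTesting.altK M P T c).Nonempty ∧
    -- the power bound for tests of asymptotic level `α`
    (∀ τ : ∀ n : ℕ, (Fin n → Ω) → ℝ, OneSidedTesting.IsTestSeq τ →
      OneSidedTesting.limsupPower τ (fun _ => P) ≤ α →
      (⨅ Q : OneSidedTesting.altK M P T c, OneSidedTesting.limsupPower τ Q) ≤
        OneSidedTesting.stdNormalCDF (-u + c / ‖κt‖)) ∧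
    -- the bound is achieved by the tests `τt`, which have asymptotic level `α`
    (OneSidedTesting.IsTestSeq τt ∧
      OneSidedTesting.limsupPower τt (fun _ => P) ≤ α ∧
      (⨅ Q : OneSidedTesting.altK M P T c, OneSidedTesting.limsupPower τt Q) =
        OneSidedTesting.stdNormalCDF (-u + c / ‖κt‖) ∧
      (⨅ Q : OneSidedTesting.altK M P T c, OneSidedTesting.liminfPower τt Q) =
        OneSidedTesting.stdNormalCDF (-u + c / ‖κt‖)) ∧
    -- uniqueness up to terms tending to `0` in `Pⁿ`-probability
    (∀ τ : ∀ n : ℕ, (Fin n → Ω) → ℝ, OneSidedTesting.IsTestSeq τ →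
      OneSidedTesting.limsupPower τ (fun _ => P) ≤ α →
      OneSidedTesting.stdNormalCDF (-u + c / ‖κt‖) ≤
        (⨅ Q : OneSidedTesting.altK M P T c, OneSidedTesting.liminfPower τ Q) →
      ∀ ε : ℝ, 0 < ε →
        Tendsto (fun n : ℕ => (OneSidedTesting.iid P n).real {x | ε ≤ |τ n x - τt n x|})
          atTop (𝓝 0)) ∧
    -- if the tangent set is linear, the tests `τt` keep the level on `H`
    (OneSidedTesting.IsClosedLinear (OneSidedTesting.tangentSet M P) →
      (⨆ Q : OneSidedTesting.hypH M P T, OneSidedTesting.limsupPower τt Q) ≤ α) := by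
  set σ := ‖κt‖ with hσ_def
  have hσ : 0 < σ := norm_pos_iff.2 hκt0
  have hgeo : κt ∈ OneSidedTesting.tangentSet M P ∧
      (∀ g ∈ OneSidedTesting.tangentSet M P, inner ℝ κ g ≤ inner ℝ κt g) ∧
      inner ℝ κ κt = σ ^ 2 := by
    rcases hκt with ⟨hG, hproj⟩ | ⟨hG, rfl⟩
    · exact hproj.mem_and_inner_le hG
    · obtain ⟨h1, h2⟩ := OneSidedTesting.linProjection_mem_and_inner_eq hG κ
      exact ⟨h1, fun g hg => (h2 g hg).le, by rw [h2 _ h1, real_inner_self_eq_norm_sq]⟩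
  obtain ⟨hmem, hle, hself⟩ := hgeo
  have hk2 : MemLp k 2 (P : Measure Ω) := (memLp_congr_ae hkκ).2 (Lp.memLp κt)
  have hk0 : ∫ x, k x ∂(P : Measure Ω) = 0 := by rw [integral_congr_ae hkκ]; exact hmem.1
  have hinner : ∀ g : Lp ℝ 2 (P : Measure Ω), ∫ x, k x * g x ∂(P : Measure Ω) = inner ℝ κt g := by
    intro g
    rw [L2.inner_def]
    refine integral_congr_ae ?_
    filter_upwards [hkκ] with x hx
    simp [hx, mul_comm]
  have hkσ : ∫ x, k x ^ 2 ∂(P : Measure Ω) = σ ^ 2 := by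
    rw [hσ_def, ← real_inner_self_eq_norm_sq, ← hinner]
    refine integral_congr_ae ?_
    filter_upwards [hkκ] with x hx
    simp [hx, pow_two]
  have hτtest : OneSidedTesting.IsTestSeq τt := hτt ▸ OneSidedTesting.isTestSeq_sumTest hk _
  -- the power of `τt` along any local sequence
  have hpower : ∀ g ∈ OneSidedTesting.tangentSet M P, ∀ γ, OneSidedTesting.IsLocalPath M P g γ →
      ∀ t : ℝ, 0 < t → ∀ Q : ℕ → ProbabilityMeasure Ω, (∀ n : ℕ, Q n = γ (t / √n)) →
      Tendsto (fun n : ℕ => ∫ x, τt n x ∂(OneSidedTesting.iid (Q n) n)) atTop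
        (𝓝 (OneSidedTesting.stdNormalCDF (-u + t * inner ℝ κt g / σ))) := by
    intro g hg γ hγ t ht Q hQ
    have hgm : Measurable g := (Lp.stronglyMeasurable g).measurable
    have := OneSidedTesting.tendsto_integral_sumTest (h := fun x => t * g x)
      (Q := fun n : ℕ => (γ (t / √n) : Measure Ω)) (hgm.const_mul t) hk
      ((Lp.memLp g).const_mul t) hk2 (by rw [integral_const_mul, hg.1, mul_zero]) hk0
      (hγ.tendsto_mul_sqrtDistSq ht (ae_eq_refl _)) hσ hkσ u
    have e : ∫ x, k x * (t * g x) ∂(P : Measure Ω) = t * inner ℝ κt g := by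
      rw [← hinner, ← integral_const_mul]
      congr 1; ext x; ring
    rw [e] at this
    simp_rw [hτt, hQ]
    exact this
  -- the least favorable local sequence
  obtain ⟨-, γ, hγ⟩ := id hmem
  set t : ℝ := c / σ ^ 2 with ht_def
  have ht : 0 < t := by positivity
  have htσ : t * σ = c / σ := by rw [ht_def]; field_simp
  set Q₀ : ℕ → ProbabilityMeasure Ω := fun n => γ (t / √n) with hQ₀
  have hQ₀K : Q₀ ∈ OneSidedTesting.altK M P T c := by
    refine ⟨⟨κt, hmem, γ, hγ, t, ht, fun n => rfl⟩, t * inner ℝ κ κt, ?_, hT.tendsto hmem hγ ht⟩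
    rw [hself, ht_def]
    exact (by field_simp : c = c / σ ^ 2 * σ ^ 2).le
  have : Nonempty (OneSidedTesting.altK M P T c) := ⟨⟨Q₀, hQ₀K⟩⟩
  have hQ₀power : Tendsto (fun n : ℕ => ∫ x, τt n x ∂(OneSidedTesting.iid (Q₀ n) n)) atTop
      (𝓝 (OneSidedTesting.stdNormalCDF (-u + c / σ))) := by
    have := hpower κt hmem γ hγ t ht Q₀ fun n => rfl
    rwa [real_inner_self_eq_norm_sq, ← hσ_def, pow_two, ← mul_assoc, mul_div_cancel_right₀ _ hσ.ne',
      htσ] at this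
  have hKpower : ∀ Q ∈ OneSidedTesting.altK M P T c, ∃ β,
      OneSidedTesting.stdNormalCDF (-u + c / σ) ≤ β ∧
      Tendsto (fun n : ℕ => ∫ x, τt n x ∂(OneSidedTesting.iid (Q n) n)) atTop (𝓝 β) := by
    rintro Q ⟨⟨g, hg, γ', hγ', s, hs, hQ⟩, l, hl, hlim⟩
    refine ⟨_, ?_, hpower g hg γ' hγ' s hs Q hQ⟩
    simp_rw [hQ] at hlim
    have := tendsto_nhds_unique hlim (hT.tendsto hg hγ' hs)
    refine monotone_cdf _ ?_
    have h1 : c ≤ s * inner ℝ κt g := by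
      calc c ≤ s * inner ℝ κ g := this ▸ hl
        _ ≤ _ := by gcongr; exact hle g hg
    gcongr
  have hPpower : Tendsto (fun n : ℕ => ∫ x, τt n x ∂(OneSidedTesting.iid P n)) atTop (𝓝 α) := by
    have := OneSidedTesting.tendsto_integral_sumTest (h := fun _ => (0 : ℝ))
      (Q := fun _ => (P : Measure Ω)) measurable_const hk (memLp_const 0) hk2 (by simp) hk0
      (by simp [OneSidedTesting.sqrtDistSq_self]) hσ hkσ u
    simp only [mul_zero, integral_zero, zero_div, add_zero, hu] at this
    simp_rw [hτt]
    exact this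
  -- the Neyman-Pearson identity along the least favorable local sequence
  have hNP : ∀ τ : ∀ n : ℕ, (Fin n → Ω) → ℝ, OneSidedTesting.IsTestSeq τ →
      Tendsto (fun n : ℕ =>
        OneSidedTesting.excess (P : Measure Ω) k t (t ^ 2 * σ ^ 2 / 2) (σ * u) τ n +
        (∫ x, τ n x ∂(OneSidedTesting.iid (Q₀ n) n) -
          Real.exp (t * (σ * u) - t ^ 2 * σ ^ 2 / 2) *
            ∫ x, τ n x ∂(OneSidedTesting.iid P n))) atTop
        (𝓝 (OneSidedTesting.stdNormalCDF (-u + c / σ) -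
          Real.exp (t * (σ * u) - t ^ 2 * σ ^ 2 / 2) * α)) := by
    intro τ hτ
    have hpath := hγ.tendsto_mul_sqrtDistSq ht (h := fun x => t * k x)
      (by filter_upwards [hkκ] with x hx; rw [hx])
    have := OneSidedTesting.tendsto_excess_add (u := u) hk hk2 hk0 hσ hkσ ht rfl hpath hτ
    rwa [htσ, hu] at this
  refine ⟨⟨Q₀, hQ₀K⟩, fun τ hτ hα => ?_, ⟨hτtest, hPpower.limsup_eq.le, ?_, ?_⟩,
    fun τ hτ hα hβ ε hε => ?_, fun hlin => ?_⟩
  · refine (ciInf_le ⟨0, ?_⟩ (⟨Q₀, hQ₀K⟩ : OneSidedTesting.altK M P T c)).trans ?_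
    · rintro _ ⟨Q, rfl⟩
      exact OneSidedTesting.limsupPower_nonneg hτ _
    · exact OneSidedTesting.limsup_le_of_tendsto_add
        (OneSidedTesting.excess_nonneg _ _ _ _ τ) (Real.exp_pos _)
        (OneSidedTesting.integral_test_mem_Icc hτ fun _ => P)
        (OneSidedTesting.integral_test_mem_Icc hτ Q₀) (hNP τ hτ) hα
  · refine le_antisymm ?_ (le_ciInf fun Q => ?_)
    · refine (ciInf_le ⟨0, ?_⟩ (⟨Q₀, hQ₀K⟩ : OneSidedTesting.altK M P T c)).trans
        hQ₀power.limsup_eq.le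
      rintro _ ⟨Q, rfl⟩
      exact OneSidedTesting.limsupPower_nonneg hτtest _
    · obtain ⟨β, hβ, hlim⟩ := hKpower Q Q.2
      exact hβ.trans hlim.limsup_eq.ge
  · refine le_antisymm ?_ (le_ciInf fun Q => ?_)
    · refine (ciInf_le ⟨0, ?_⟩ (⟨Q₀, hQ₀K⟩ : OneSidedTesting.altK M P T c)).trans
        hQ₀power.liminf_eq.le
      rintro _ ⟨Q, rfl⟩
      exact OneSidedTesting.liminfPower_nonneg hτtest _
    · obtain ⟨β, hβ, hlim⟩ := hKpower Q Q.2
      exact hβ.trans hlim.liminf_eq.ge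
  · have hβ₀ : OneSidedTesting.stdNormalCDF (-u + c / σ) ≤ OneSidedTesting.liminfPower τ Q₀ := by
      refine hβ.trans (ciInf_le ⟨0, ?_⟩ (⟨Q₀, hQ₀K⟩ : OneSidedTesting.altK M P T c))
      rintro _ ⟨Q, rfl⟩
      exact OneSidedTesting.liminfPower_nonneg hτ _
    have hex := OneSidedTesting.tendsto_zero_of_tendsto_add
      (OneSidedTesting.excess_nonneg _ _ _ _ τ) (Real.exp_pos _)
      (OneSidedTesting.integral_test_mem_Icc hτ fun _ => P)
      (OneSidedTesting.integral_test_mem_Icc hτ Q₀) (hNP τ hτ) hα hβ₀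
    rw [hτt]
    exact OneSidedTesting.tendsto_measureReal_of_tendsto_excess hk hk2 hk0 hσ hkσ ht hτ hex hε
  · obtain ⟨-, V, hV⟩ := hlin
    refine Real.iSup_le ?_ hα0.le
    rintro ⟨Q, ⟨g, hg, γ', hγ', s, hs, hQ⟩, l, hl, hlim⟩
    have hlim' := hpower g hg γ' hγ' s hs Q hQ
    refine hlim'.limsup_eq.le.trans ?_
    simp_rw [hQ] at hlim
    have hls := tendsto_nhds_unique hlim (hT.tendsto hg hγ' hs)
    have hneg := hle (-g) (by rw [← hV] at hg ⊢; exact V.neg_mem hg)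
    rw [inner_neg_right, inner_neg_right, neg_le_neg_iff] at hneg
    rw [← hu]
    refine monotone_cdf _ ?_
    have h1 : s * inner ℝ κt g ≤ 0 := by
      calc s * inner ℝ κt g ≤ s * inner ℝ κ g := by gcongr
        _ ≤ 0 := hls ▸ hl
    have : s * inner ℝ κt g / σ ≤ 0 := div_nonpos_of_nonpos_of_nonneg h1 hσ.le
    linarith
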